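/- Let $1<p<\infty$ and let $H^p(\mathbb C_+)$ be the Hardy space of the upper half-plane $\mathbb C_+=\{z:\operatorname{Im}z>0\}$, that is, the normed space of all holomorphic functions $f$ on $\mathbb C_+$ with $$\|f\|_p=\sup_{y>0}\Bigl(\int_{-\infty}^{\infty}|f(x+iy)|^p\,dx\Bigr)^{1/p}<\infty .$$ For $f\in H^p(\mathbb C_+)$ put $$(Cf)(z)=\frac1z\int_0^z f(\zeta)\,d\zeta,\qquad z\in\mathbb C_+,$$ where the integral is taken along the segment from $0$ to $z$ (it converges absolutely). If $p\neq 2$, then $C$ is a bounded linear operator on $H^p(\mathbb C_+)$, and the operator $V=\frac{2(p-1)}{p}C-I$ satisfies $$\|V\|_p>1,$$ where $\|V\|_p$ is the norm of $V$ as an operator on $H^p(\mathbb C_+)$. -/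

import Mathlib

open MeasureTheory UpperHalfPlane
open scoped ENNReal Manifold

noncomputable section

/-- The Hardy norm `sup_{y > 0} (∫ |f (x + i y)|^p dx)^(1/p)`, with values in `[0, ∞]`, of a function
`f` on the open upper half-plane. -/
def hardyENorm (p : ℝ) (f : ℍ → ℂ) : ℝ≥0∞ :=
  ⨆ y : Set.Ioi (0 : ℝ), eLpNorm (fun x : ℝ => f ⟨⟨x, y⟩, y.2⟩) (ENNReal.ofReal p) volume

/-- Every horizontal line is continuously parametrized. -/
theorem continuous_horizontal (y : Set.Ioi (0 : ℝ)) :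
    Continuous (fun x : ℝ => (⟨⟨x, y⟩, y.2⟩ : ℍ)) := by
  rw [UpperHalfPlane.isEmbedding_coe.continuous_iff]
  have h : Continuous fun x : ℝ => (x : ℂ) + ((y : ℝ) : ℂ) * Complex.I := by fun_prop
  refine h.congr fun x => ?_
  apply Complex.ext <;> simp

theorem hardyENorm_add_le {p : ℝ} (hp : 1 < p) {f g : ℍ → ℂ} (hf : Continuous f)
    (hg : Continuous g) : hardyENorm p (f + g) ≤ hardyENorm p f + hardyENorm p g := by
  refine iSup_le fun y => ?_
  have h1 : (1 : ℝ≥0∞) ≤ ENNReal.ofReal p := by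
    simpa using ENNReal.ofReal_le_ofReal hp.le
  refine (eLpNorm_add_le (hf.comp (continuous_horizontal y)).aestronglyMeasurable
    (hg.comp (continuous_horizontal y)).aestronglyMeasurable h1).trans ?_
  exact add_le_add
    (le_iSup (fun y : Set.Ioi (0 : ℝ) =>
      eLpNorm (fun x : ℝ => f ⟨⟨x, y⟩, y.2⟩) (ENNReal.ofReal p) volume) y)
    (le_iSup (fun y : Set.Ioi (0 : ℝ) =>
      eLpNorm (fun x : ℝ => g ⟨⟨x, y⟩, y.2⟩) (ENNReal.ofReal p) volume) y)

theorem hardyENorm_smul (p : ℝ) (c : ℂ) (f : ℍ → ℂ) :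
    hardyENorm p (c • f) = ‖c‖ₑ * hardyENorm p f := by
  unfold hardyENorm
  rw [ENNReal.mul_iSup]
  exact iSup_congr fun y =>
    eLpNorm_const_smul c (fun x : ℝ => f ⟨⟨x, y⟩, y.2⟩) (ENNReal.ofReal p) volume

theorem hardyENorm_zero (p : ℝ) : hardyENorm p 0 = 0 := by
  have h := hardyENorm_smul p 0 0
  simpa using h

theorem eq_zero_of_hardyENorm_eq_zero {p : ℝ} (hp : 1 < p) {f : ℍ → ℂ} (hf : Continuous f)
    (h : hardyENorm p f = 0) : f = 0 := by
  have hp0 : ENNReal.ofReal p ≠ 0 := by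
    simpa using (by linarith : 0 < p)
  funext z
  let y : Set.Ioi (0 : ℝ) := ⟨z.im, z.im_pos⟩
  have hy := (iSup_eq_bot.mp h) y
  have hc := hf.comp (continuous_horizontal y)
  have h0 := (eLpNorm_eq_zero_iff hc.aestronglyMeasurable hp0).mp hy
  have h1 := (hc.ae_eq_iff_eq (volume : Measure ℝ) continuous_zero).mp h0
  exact congrFun h1 z.re

/-- The functions of the Hardy space `H^p` of the upper half-plane: the holomorphic functions with
finite Hardy norm. -/
def hardySubmodule (p : ℝ) [hp : Fact (1 < p)] : Submodule ℂ (ℍ → ℂ) where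
  carrier := {f | MDifferentiable 𝓘(ℂ) 𝓘(ℂ) f ∧ hardyENorm p f < ∞}
  zero_mem' := ⟨mdifferentiable_const, by simp [hardyENorm_zero]⟩
  add_mem' := fun hf hg => ⟨hf.1.add hg.1,
    (hardyENorm_add_le hp.out hf.1.continuous hg.1.continuous).trans_lt
      (ENNReal.add_lt_top.mpr ⟨hf.2, hg.2⟩)⟩
  smul_mem' := fun c f hf => ⟨hf.1.const_smul c, by
    rw [hardyENorm_smul]
    exact ENNReal.mul_lt_top enorm_lt_top hf.2⟩

/-- The Hardy space `H^p` of the upper half-plane. This is a type of its own, so that its topology is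
the one of the Hardy norm and not that of pointwise convergence. -/
def HardySpace (p : ℝ) [Fact (1 < p)] : Type := ↥(hardySubmodule p)

namespace HardySpace

variable {p : ℝ} [Fact (1 < p)]

instance : AddCommGroup (HardySpace p) := inferInstanceAs (AddCommGroup ↥(hardySubmodule p))

instance : Module ℂ (HardySpace p) := inferInstanceAs (Module ℂ ↥(hardySubmodule p))

/-- The holomorphic function underlying an element of `H^p`. -/
def toFun (f : HardySpace p) : ℍ → ℂ := Subtype.val f

instance : CoeFun (HardySpace p) (fun _ => ℍ → ℂ) := ⟨toFun⟩

instance : Norm (HardySpace p) := ⟨fun f => (hardyENorm p f).toReal⟩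

theorem normedSpaceCore : NormedSpace.Core ℂ (HardySpace p) where
  norm_nonneg _ := ENNReal.toReal_nonneg
  norm_smul c f := by
    change (hardyENorm p (c • f.toFun)).toReal = ‖c‖ * (hardyENorm p f).toReal
    rw [hardyENorm_smul, ENNReal.toReal_mul, toReal_enorm]
  norm_triangle f g := by
    change (hardyENorm p (f.toFun + g.toFun)).toReal ≤ _
    exact (ENNReal.toReal_mono (ENNReal.add_lt_top.mpr ⟨f.2.2, g.2.2⟩).ne
      (hardyENorm_add_le Fact.out f.2.1.continuous g.2.1.continuous)).trans_eq
      (ENNReal.toReal_add f.2.2.ne g.2.2.ne)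
  norm_eq_zero_iff f := by
    constructor
    · intro h
      have h0 : hardyENorm p f = 0 :=
        ((ENNReal.toReal_eq_zero_iff _).mp h).resolve_right f.2.2.ne
      exact Subtype.ext (eq_zero_of_hardyENorm_eq_zero Fact.out f.2.1.continuous h0)
    · rintro rfl
      change (hardyENorm p 0).toReal = 0
      simp [hardyENorm_zero]

instance : NormedAddCommGroup (HardySpace p) := NormedAddCommGroup.ofCore normedSpaceCore

instance : NormedSpace ℂ (HardySpace p) := NormedSpace.ofCore normedSpaceCore

end HardySpace

/-- The integrand of `∫_0^z f(ζ) dζ` for the segment `ζ = t z`, `0 < t ≤ 1`, which lies in the upper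
half-plane. (The value at the single point `t = 0` plays no role.) -/
def segmentIntegrand (f : ℍ → ℂ) (z : ℍ) (t : ℝ) : ℂ :=
  f (ofComplex ((t : ℂ) * (z : ℂ))) * (z : ℂ)

/-- `(Cf)(z) = (1/z) ∫_0^z f(ζ) dζ`, the integral being taken along the segment from `0` to `z`. -/
def cesaro (f : ℍ → ℂ) (z : ℍ) : ℂ :=
  1 / (z : ℂ) * ∫ t in (0 : ℝ)..1, segmentIntegrand f z t

end

/-! Put L = log(-iz), a = 1 - 1/p, σ = ±1 and h = exp(E(L)) with E = `chirpExponent p`. If f =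
(zh)', then Cf = h. Since z d/dz = d/dL, f = (1 + E'(L))h = (a - W)h with W = 2(1 + iσ)L - 2πi, and
therefore Vf = 2ah - f = (a + W)h. It is enough to show that (a + W)h has strictly larger norm than
(a - W)h.

On the boundary x = ±e^u one has L = u + iθ with θ = ∓π/2. With s = u - σθ and b = 2π - 4θ this
gives W = 2s - i(b - 2σs), while |h|^p dx is a constant times e^{-ps²} ds, because the term -L/p of
E cancels the Jacobian e^u. So the integrals of ((a + 2εs)² + (b - 2σs)²)^{p/2} e^{-ps²} for ε = -1
and ε = 1 have to be compared. The term 2πiL of E makes b = 0 on the negative half-line, where s ↦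
-s exchanges the two integrals. On the positive half-line b = 4π. There, pairing s with -s, the two
bases for ε = 1 and the two for ε = -1 have the same sum but different spread, so strict convexity
or concavity of x^{p/2} separates them once σ is chosen according to the sign of p - 2
(`rpow_add_rpow_lt`, `integral_gaussDensity_lt`). For p = 2 they would agree.

Two analytic facts support this. For functions bounded up to the boundary the Hardy norm is the
boundary L^p norm, by duality and Phragmén–Lindelöf (`BoundedUpToBoundary.hardyENorm_eq`). And C is
defined and bounded, by the growth bound `exists_norm_le_im_rpow` and Hardy's inequality
`HardySpace.hardyENorm_cesaro_le`. -/

open Set Filter Topology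

/-! ### Mean value inequalities, holomorphic parameter integrals, pointwise growth in H^p -/

/-- A holomorphic function is dominated at the centre of a circle by its mean over the circle. -/
theorem enorm_le_lintegral_circle {f : ℂ → ℂ} {z : ℂ} {r : ℝ} (hr : 0 < r)
    (hf : DiffContOnCl ℂ f (Metric.ball z r)) :
    ENNReal.ofReal (2 * Real.pi) * ‖f z‖ₑ ≤
      ∫⁻ θ in Ioo (-Real.pi) Real.pi, ‖f (z + r * (Real.cos θ + Real.sin θ * Complex.I))‖ₑ := by
  have hpi := Real.pi_pos
  have h1 := DiffContOnCl.circleAverage (f := f) (c := z) (R := r) (by rwa [abs_of_pos hr])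
  have hper : Function.Periodic (fun θ => f (circleMap z r θ)) (2 * Real.pi) := fun θ => by
    simp only [periodic_circleMap z r θ]
  have h2 := hper.intervalIntegral_add_eq 0 (-Real.pi)
  rw [zero_add, show -Real.pi + 2 * Real.pi = Real.pi by ring] at h2
  have h3 : ((2 * Real.pi : ℝ)) • f z = ∫ θ in (-Real.pi)..Real.pi, f (circleMap z r θ) := by
    rw [← h1, Real.circleAverage, smul_smul, mul_inv_cancel₀ (by positivity), one_smul, h2]
  have h4 : ENNReal.ofReal (2 * Real.pi) * ‖f z‖ₑ = ‖((2 * Real.pi : ℝ)) • f z‖ₑ := by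
    rw [enorm_smul, Real.enorm_of_nonneg (by positivity)]
  rw [h4, h3, intervalIntegral.integral_of_le (by linarith), integral_Ioc_eq_integral_Ioo]
  refine (enorm_integral_le_lintegral_enorm _).trans (le_of_eq ?_)
  refine lintegral_congr fun θ => ?_
  rw [circleMap, Complex.exp_mul_I]
  push_cast
  rfl

/-- A holomorphic function is dominated at the centre of a disc by a multiple of its mean over the
disc. -/
theorem enorm_le_lintegral_ball {f : ℂ → ℂ} {z : ℂ} {R : ℝ} (hR : 0 < R)
    (hf : DifferentiableOn ℂ f (Metric.ball z R)) :
    ENNReal.ofReal (R ^ 2 / 2 * Real.pi) * ‖f z‖ₑ ≤ ∫⁻ w in Metric.ball z R, ‖f w‖ₑ := by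
  have hpi := Real.pi_pos
  have hmem : ∀ p ∈ Ioo (R / 2) R ×ˢ Ioo (-Real.pi) Real.pi,
      z + p.1 * (Real.cos p.2 + Real.sin p.2 * Complex.I) ∈ Metric.ball z R := by
    rintro ⟨r, θ⟩ ⟨hr, -⟩
    rw [mem_ball_iff_norm, add_sub_cancel_left, norm_mul, Complex.norm_real,
      Complex.ofReal_cos, Complex.ofReal_sin, Complex.norm_cos_add_sin_mul_I, mul_one,
      Real.norm_of_nonneg (by linarith [hr.1])]
    exact hr.2
  have hcont : ContinuousOn (fun p : ℝ × ℝ => ENNReal.ofReal p.1 *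
      ‖f (z + p.1 * (Real.cos p.2 + Real.sin p.2 * Complex.I))‖ₑ)
      (Ioo (R / 2) R ×ˢ Ioo (-Real.pi) Real.pi) := by
    have h1 : ContinuousOn (fun p : ℝ × ℝ => ENNReal.ofReal
      (p.1 * ‖f (z + p.1 * (Real.cos p.2 + Real.sin p.2 * Complex.I))‖))
      (Ioo (R / 2) R ×ˢ Ioo (-Real.pi) Real.pi) := by
      refine ENNReal.continuous_ofReal.comp_continuousOn (continuous_fst.continuousOn.mul
        (ContinuousOn.norm ?_))
      exact hf.continuousOn.comp (by fun_prop) hmem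
    refine h1.congr fun p hp => ?_
    have hp1 : 0 ≤ p.1 := by linarith [hp.1.1]
    simp only [ENNReal.ofReal_mul hp1, ofReal_norm]
  -- Only the annulus R/2 < r < R is used. There the polar weight r is at least R/2, which gives the
  -- constant (R/2)(R/2)(2π) = πR²/2.
  calc ENNReal.ofReal (R ^ 2 / 2 * Real.pi) * ‖f z‖ₑ
      = ∫⁻ _ in Ioo (R / 2) R, ENNReal.ofReal (R / 2) *
          (ENNReal.ofReal (2 * Real.pi) * ‖f z‖ₑ) := by
        rw [setLIntegral_const, Real.volume_Ioo, mul_right_comm, ← mul_assoc,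
          ← ENNReal.ofReal_mul (by positivity), ← ENNReal.ofReal_mul (by nlinarith)]
        congr 2
        ring
    _ ≤ ∫⁻ r in Ioo (R / 2) R, ∫⁻ θ in Ioo (-Real.pi) Real.pi, ENNReal.ofReal r *
          ‖f (z + r * (Real.cos θ + Real.sin θ * Complex.I))‖ₑ := by
        refine setLIntegral_mono' measurableSet_Ioo fun r hr => ?_
        have hr0 : 0 < r := by linarith [hr.1]
        rw [lintegral_const_mul' _ _ ENNReal.ofReal_ne_top]
        refine mul_le_mul' (ENNReal.ofReal_le_ofReal hr.1.le) (enorm_le_lintegral_circle hr0 ?_)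
        refine DifferentiableOn.diffContOnCl (hf.mono ?_)
        rw [closure_ball _ hr0.ne']
        exact Metric.closedBall_subset_ball hr.2
    _ = ∫⁻ p in Ioo (R / 2) R ×ˢ Ioo (-Real.pi) Real.pi, ENNReal.ofReal p.1 *
          ‖f (z + p.1 * (Real.cos p.2 + Real.sin p.2 * Complex.I))‖ₑ := by
        rw [Measure.volume_eq_prod, ← Measure.prod_restrict]
        rw [lintegral_prod]
        rw [Measure.prod_restrict]
        exact hcont.aemeasurable (measurableSet_Ioo.prod measurableSet_Ioo)
    _ ≤ ∫⁻ p in polarCoord.target, ENNReal.ofReal p.1 •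
          (fun w => (Metric.ball z R).indicator (fun w => ‖f w‖ₑ) (z + w))
            (Complex.polarCoord.symm p) := by
        refine (setLIntegral_mono' (measurableSet_Ioo.prod measurableSet_Ioo)
          fun p hp => ?_).trans (lintegral_mono_set ?_)
        · rw [Complex.polarCoord_symm_apply]
          simp only [smul_eq_mul]
          rw [indicator_of_mem (hmem p hp)]
        · rw [polarCoord_target]
          exact prod_mono (fun r hr => (half_pos hR).trans hr.1) subset_rfl
    _ = ∫⁻ w in Metric.ball z R, ‖f w‖ₑ := by
        rw [Complex.lintegral_comp_polarCoord_symm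
          (fun w => (Metric.ball z R).indicator (fun w => ‖f w‖ₑ) (z + w)),
          lintegral_add_left_eq_self
          (fun w => (Metric.ball z R).indicator (fun w => ‖f w‖ₑ) w),
          lintegral_indicator Metric.isOpen_ball.measurableSet]

/-- A parametric integral of functions that are holomorphic in the parameter and locally dominated
is holomorphic. -/
theorem differentiableOn_integral_of_dominated {α : Type*} [MeasurableSpace α] {μ : Measure α}
    {F : ℂ → α → ℂ} {U : Set ℂ} (hU : IsOpen U)
    (hm : ∀ z ∈ U, AEStronglyMeasurable (F z) μ)
    (hd : ∀ᵐ a ∂μ, DifferentiableOn ℂ (fun z => F z a) U)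
    (hb : ∀ z ∈ U, ∃ r > 0, ∃ bound : α → ℝ, Integrable bound μ ∧
      ∀ᵐ a ∂μ, ∀ w ∈ Metric.ball z r, ‖F w a‖ ≤ bound a) :
    DifferentiableOn ℂ (fun z => ∫ a, F z a ∂μ) U := by
  intro z hz
  obtain ⟨r, hr, bound, hbi, hbd⟩ := hb z hz
  obtain ⟨ε, hε, hεU⟩ := Metric.isOpen_iff.mp hU z hz
  set ρ := min r ε / 2 with hρ
  have hρ0 : 0 < ρ := by positivity
  have hsub : ∀ w ∈ Metric.ball z ρ, Metric.closedBall w (ρ / 2) ⊆ Metric.ball z (min r ε) := by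
    intro w hw x hx
    rw [Metric.mem_ball] at *
    rw [Metric.mem_closedBall] at hx
    linarith [dist_triangle x w z]
  have hminr : Metric.ball z (min r ε) ⊆ Metric.ball z r := Metric.ball_subset_ball (min_le_left _ _)
  have hminU : Metric.ball z (min r ε) ⊆ U :=
    (Metric.ball_subset_ball (min_le_right _ _)).trans hεU
  have hder : ∀ᵐ a ∂μ, ∀ w ∈ Metric.ball z ρ,
      HasDerivAt (fun z => F z a) (deriv (fun z => F z a) w) w := by
    filter_upwards [hd] with a ha w hw
    refine (ha.differentiableAt (hU.mem_nhds (hminU (hsub w hw ?_)))).hasDerivAt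
    exact Metric.mem_closedBall_self (by positivity)
  -- The derivative is measurable in the parameter as a limit of difference quotients along a
  -- sequence of steps.
  have hmeas' : AEStronglyMeasurable (fun a => deriv (fun z => F z a) z) μ := by
    let u : ℕ → ℂ := fun n => ((ρ / 2 / (n + 1) : ℝ) : ℂ)
    have hu0 : Tendsto u atTop (𝓝[≠] 0) := by
      refine tendsto_nhdsWithin_iff.mpr ⟨?_, Eventually.of_forall fun n => ?_⟩
      · have h1 : Tendsto (fun n : ℕ => ρ / 2 / ((n : ℝ) + 1)) atTop (𝓝 0) :=
          tendsto_const_nhds.div_atTop (tendsto_atTop_add_const_right _ _ tendsto_natCast_atTop_atTop)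
        have h2 := (Complex.continuous_ofReal.tendsto 0).comp h1
        simpa [u, Function.comp_def] using h2
      · have : ρ / 2 / ((n : ℝ) + 1) ≠ 0 := by positivity
        exact Complex.ofReal_ne_zero.mpr this
    have huU : ∀ n, z + u n ∈ U := by
      intro n
      refine hminU (hsub z (Metric.mem_ball_self hρ0) ?_)
      rw [mem_closedBall_iff_norm, add_sub_cancel_left, Complex.norm_real,
        Real.norm_of_nonneg (by positivity)]
      exact div_le_self (by positivity) (by linarith [(Nat.cast_nonneg n : (0 : ℝ) ≤ n)])
    refine aestronglyMeasurable_of_tendsto_ae atTop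
      (f := fun n a => (u n)⁻¹ • (F (z + u n) a - F z a)) (fun n => ?_) ?_
    · exact ((hm _ (huU n)).sub (hm z hz)).const_smul (u n)⁻¹
    · filter_upwards [hder] with a ha
      have := hasDerivAt_iff_tendsto_slope_zero.mp (ha z (Metric.mem_ball_self hρ0))
      exact this.comp hu0
  -- Cauchy's estimate on circles of radius ρ/2 turns the bound on F into a bound on its derivative.
  refine (hasDerivAt_integral_of_dominated_loc_of_deriv_le (bound := fun a => bound a / (ρ / 2))
    (Metric.ball_mem_nhds z hρ0) ?_ ?_ hmeas' ?_ (hbi.div_const _)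
    hder).2.differentiableAt.differentiableWithinAt
  · filter_upwards [hU.mem_nhds hz] with w hw using hm w hw
  · refine hbi.mono' (hm z hz) ?_
    filter_upwards [hbd] with a ha using ha z (Metric.mem_ball_self hr)
  · filter_upwards [hbd, hd] with a ha hda w hw
    refine Complex.norm_deriv_le_of_forall_mem_sphere_norm_le (by positivity) ?_ fun x hx => ?_
    · refine DifferentiableOn.diffContOnCl (hda.mono ?_)
      rw [closure_ball _ (by positivity)]
      exact (hsub w hw).trans hminU
    · exact ha x (hminr (hsub w hw (Metric.sphere_subset_closedBall hx)))

/-- Functions of the Hardy space are `O((Im z)^(-1/p))`. -/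
theorem exists_norm_le_im_rpow {p : ℝ} [hp : Fact (1 < p)] (f : HardySpace p) :
    ∃ K : ℝ, 0 ≤ K ∧ ∀ z : ℍ, ‖f z‖ ≤ K * z.im ^ (-1 / p) := by
  have hp1 : 1 < p := hp.out
  have hpi := Real.pi_pos
  set M := hardyENorm p f with hM
  have hMtop : M ≠ ∞ := f.2.2.ne
  set F : ℂ → ℂ := f.toFun ∘ ofComplex with hF
  have hFd : DifferentiableOn ℂ F {z | 0 < z.im} := UpperHalfPlane.mdifferentiable_iff.mp f.2.1
  -- The disc of radius y/2 contributes the factor πy²/8. Its circumscribed square has side y, and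
  -- Hölder on each horizontal line bounds the integral by y · M y^{1 - 1/p}.
  refine ⟨8 / Real.pi * M.toReal, by positivity, fun z => ?_⟩
  have hy := z.im_pos
  set y := z.im with hydef
  have hz : f z = F z := by simp [F]
  have hball : Metric.ball (z : ℂ) (y / 2) ⊆
      Ioo (z.re - y / 2) (z.re + y / 2) ×ℂ Ioo (y / 2) (3 * y / 2) := by
    intro w hw
    rw [mem_ball_iff_norm] at hw
    have h1 := (Complex.abs_re_le_norm (w - z)).trans_lt hw
    have h2 := (Complex.abs_im_le_norm (w - z)).trans_lt hw
    rw [Complex.sub_re, abs_lt] at h1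
    rw [Complex.sub_im, abs_lt] at h2
    have e1 : (z : ℂ).re = z.re := rfl
    have e2 : (z : ℂ).im = y := rfl
    rw [e1] at h1
    rw [e2] at h2
    exact ⟨⟨by linarith, by linarith⟩, ⟨by linarith, by linarith⟩⟩
  have hFdb : DifferentiableOn ℂ F (Metric.ball (z : ℂ) (y / 2)) := by
    refine hFd.mono fun w hw => ?_
    have := (hball hw).2.1
    change 0 < w.im
    linarith
  have h1 := enorm_le_lintegral_ball (half_pos hy) hFdb
  have hline : ∀ τ ∈ Ioo (y / 2) (3 * y / 2),
      ∫⁻ s in Ioo (z.re - y / 2) (z.re + y / 2), ‖F (s + τ * Complex.I)‖ₑ ≤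
        M * ENNReal.ofReal y ^ (1 - 1 / p) := by
    intro τ hτ
    have hτ0 : 0 < τ := by linarith [hτ.1]
    have hcont : Continuous fun s : ℝ => F (s + τ * Complex.I) := by
      refine continuous_iff_continuousAt.mpr fun s => ?_
      have hs : (s + τ * Complex.I : ℂ) ∈ {z : ℂ | 0 < z.im} := by simpa using hτ0
      refine ContinuousAt.comp (f := fun s : ℝ => (s + τ * Complex.I : ℂ)) (g := F) ?_ (by fun_prop)
      exact (hFd.differentiableAt
        ((isOpen_lt continuous_const Complex.continuous_im).mem_nhds hs)).continuousAt
    have h2 := eLpNorm_le_eLpNorm_mul_rpow_measure_univ (p := 1) (q := ENNReal.ofReal p)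
      (μ := volume.restrict (Ioo (z.re - y / 2) (z.re + y / 2)))
      (by simpa using ENNReal.ofReal_le_ofReal hp1.le) hcont.aestronglyMeasurable
    rw [eLpNorm_one_eq_lintegral_enorm] at h2
    refine h2.trans ?_
    rw [Measure.restrict_apply_univ, Real.volume_Ioo, ENNReal.toReal_one,
      ENNReal.toReal_ofReal (by linarith), show z.re + y / 2 - (z.re - y / 2) = y by ring, div_one]
    gcongr
    refine (eLpNorm_mono_measure _ Measure.restrict_le_self).trans ?_
    refine le_trans (le_of_eq ?_) (le_iSup _ (⟨τ, hτ0⟩ : Ioi (0 : ℝ)))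
    congr 1
    funext s
    simp only [F, Function.comp_apply]
    congr 1
    rw [ofComplex_apply_of_im_pos (by simpa using hτ0)]
    ext1
    apply Complex.ext <;> simp
  have h2 : ∫⁻ w in Metric.ball (z : ℂ) (y / 2), ‖F w‖ₑ ≤
      ENNReal.ofReal y * (M * ENNReal.ofReal y ^ (1 - 1 / p)) := by
    have hpre : Complex.measurableEquivRealProd.symm ⁻¹'
        (Ioo (z.re - y / 2) (z.re + y / 2) ×ℂ Ioo (y / 2) (3 * y / 2)) =
        Ioo (z.re - y / 2) (z.re + y / 2) ×ˢ Ioo (y / 2) (3 * y / 2) := by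
      ext q
      simp [Complex.mem_reProdIm, Complex.measurableEquivRealProd_symm_apply]
    have hcont : ContinuousOn (fun q : ℝ × ℝ => ‖F (q.1 + q.2 * Complex.I)‖ₑ)
        (Ioo (z.re - y / 2) (z.re + y / 2) ×ˢ Ioo (y / 2) (3 * y / 2)) := by
      refine ContinuousOn.enorm (hFd.continuousOn.comp (by fun_prop) ?_)
      rintro q ⟨-, hq⟩
      have : 0 < q.2 := by linarith [hq.1]
      simpa using this
    refine (lintegral_mono_set hball).trans ?_
    rw [← Complex.volume_preserving_equiv_real_prod.symm.setLIntegral_comp_preimage_emb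
      Complex.measurableEquivRealProd.symm.measurableEmbedding, hpre]
    simp only [Complex.measurableEquivRealProd_symm_apply, Complex.mk_eq_add_mul_I]
    rw [Measure.volume_eq_prod, ← Measure.prod_restrict, lintegral_prod_symm]
    · refine (setLIntegral_mono' measurableSet_Ioo hline).trans (le_of_eq ?_)
      rw [setLIntegral_const, Real.volume_Ioo, mul_comm]
      congr 2
      ring
    · rw [Measure.prod_restrict]
      exact hcont.aemeasurable (measurableSet_Ioo.prod measurableSet_Ioo)
  have h3 := h1.trans h2
  rw [← ENNReal.ofReal_toReal hMtop, ENNReal.ofReal_rpow_of_pos hy, ← ofReal_norm,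
    ← ENNReal.ofReal_mul ENNReal.toReal_nonneg, ← ENNReal.ofReal_mul hy.le,
    ← ENNReal.ofReal_mul (by positivity), ENNReal.ofReal_le_ofReal_iff (by positivity)] at h3
  rw [hz]
  have h4 : y ^ (1 - 1 / p) = y * y ^ (-1 / p) := by
    rw [show 1 - 1 / p = 1 + -1 / p by ring, Real.rpow_add hy, Real.rpow_one]
  rw [h4] at h3
  have h5 : y ^ 2 * ‖F z‖ ≤ y ^ 2 * (8 / Real.pi * M.toReal * y ^ (-1 / p)) := by
    have h6 := mul_le_mul_of_nonneg_left h3 (show 0 ≤ 8 / Real.pi by positivity)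
    refine le_trans (le_of_eq ?_) (h6.trans (le_of_eq ?_))
    · field_simp
      ring
    · ring
  exact le_of_mul_le_mul_left h5 (by positivity)

/-! ### Boundary values and the Hardy norm -/

/-- The functions on `ℂ` that are bounded on the closed upper half-plane, holomorphic inside and
continuous up to the boundary, except perhaps at the origin. -/
structure BoundedUpToBoundary (f : ℂ → ℂ) (K : ℝ) : Prop where
  differentiableOn : DifferentiableOn ℂ f {z | 0 < z.im}
  continuousOn : ContinuousOn f ({z | 0 ≤ z.im} \ {0})
  norm_le : ∀ z, 0 ≤ z.im → ‖f z‖ ≤ K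

namespace BoundedUpToBoundary

variable {f : ℂ → ℂ} {K : ℝ}

theorem continuous_line (hf : BoundedUpToBoundary f K) {y : ℝ} (hy : 0 < y) :
    Continuous fun x : ℝ => f (x + y * Complex.I) := by
  refine hf.differentiableOn.continuousOn.comp_continuous (by fun_prop) fun x => ?_
  simpa using hy

theorem aestronglyMeasurable_line (hf : BoundedUpToBoundary f K) {ζ : ℂ} (hζ : 0 ≤ ζ.im) :
    AEStronglyMeasurable (fun x : ℝ => f (x + ζ)) := by
  have h : ContinuousOn (fun x : ℝ => f (x + ζ)) {-ζ.re}ᶜ := by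
    refine hf.continuousOn.comp (by fun_prop) fun x hx => ⟨by simpa using hζ, fun h0 => hx ?_⟩
    have := congrArg Complex.re h0
    simp only [Complex.add_re, Complex.ofReal_re, Complex.zero_re] at this
    simp only [mem_singleton_iff]
    linarith
  have h1 := h.aestronglyMeasurable (μ := volume) (measurableSet_singleton _).compl
  rwa [Measure.restrict_eq_self_of_ae_mem (by simp [ae_iff, measure_singleton])] at h1

/-- The pairing of the horizontal translates of `f` with an integrable function is bounded by its
bound on the real line. -/
theorem norm_integral_mul_le (hf : BoundedUpToBoundary f K) {g : ℝ → ℂ} (hg : Integrable g)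
    {A : ℝ} (hA : ∀ t : ℝ, ‖∫ x : ℝ, f (x + t) * g x‖ ≤ A) {y : ℝ} (hy : 0 ≤ y) :
    ‖∫ x : ℝ, f (x + y * Complex.I) * g x‖ ≤ A := by
  have him : ∀ (x : ℝ) (ζ : ℂ), (x + ζ * Complex.I : ℂ).im = ζ.re := fun x ζ => by simp
  have hmeas : ∀ ζ : ℂ, 0 ≤ ζ.re →
      AEStronglyMeasurable (fun x : ℝ => f (x + ζ * Complex.I) * g x) := fun ζ hζ =>
    (hf.aestronglyMeasurable_line (by simpa using hζ)).mul hg.1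
  have hbound : ∀ ζ : ℂ, 0 ≤ ζ.re → ∀ x : ℝ, ‖f (x + ζ * Complex.I) * g x‖ ≤ K * ‖g x‖ :=
    fun ζ hζ x => by
      rw [norm_mul]
      exact mul_le_mul_of_nonneg_right (hf.norm_le _ (by rwa [him])) (norm_nonneg _)
  have hopen : IsOpen {ζ : ℂ | 0 < ζ.re} := isOpen_lt continuous_const Complex.continuous_re
  have hclos : closure {ζ : ℂ | 0 < ζ.re} = {ζ : ℂ | 0 ≤ ζ.re} := Complex.closure_setOfPred_lt_re 0
  -- The variable is rotated: real ζ = y is the line at height y, and ζ = it is the real translate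
  -- by -t. Thus `hA` bounds G on the imaginary axis, and G is bounded on the closed right
  -- half-plane.
  set G : ℂ → ℂ := fun ζ => ∫ x : ℝ, f (x + ζ * Complex.I) * g x with hG
  have hGb : ∀ ζ : ℂ, 0 ≤ ζ.re → ‖G ζ‖ ≤ ∫ x, K * ‖g x‖ := fun ζ hζ =>
    norm_integral_le_of_norm_le (hg.norm.const_mul K) (ae_of_all _ (hbound ζ hζ))
  have hdc : DiffContOnCl ℂ G {ζ | 0 < ζ.re} := by
    constructor
    · refine differentiableOn_integral_of_dominated hopen (fun ζ hζ => hmeas ζ (le_of_lt hζ))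
        (ae_of_all _ fun x => ?_) fun ζ hζ => ?_
      · refine DifferentiableOn.mul_const (hf.differentiableOn.comp (by fun_prop) ?_) _
        intro ζ hζ
        simpa using hζ
      · obtain ⟨r, hr, hsub⟩ := Metric.isOpen_iff.mp hopen ζ hζ
        exact ⟨r, hr, _, hg.norm.const_mul K,
          ae_of_all _ fun x w hw => hbound w (le_of_lt (hsub hw)) x⟩
    · rw [hclos]
      intro ζ hζ
      refine continuousWithinAt_of_dominated (bound := fun x => K * ‖g x‖) ?_ ?_
        (hg.norm.const_mul K) ?_
      · filter_upwards [self_mem_nhdsWithin] with w hw using hmeas w hw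
      · filter_upwards [self_mem_nhdsWithin] with w hw using ae_of_all _ (hbound w hw)
      · have hne : ∀ᵐ x : ℝ, x ≠ ζ.im := by
          simp [ae_iff, measure_singleton]
        filter_upwards [hne] with x hx
        refine ContinuousWithinAt.mul ?_ continuousWithinAt_const
        have hx0 : (x + ζ * Complex.I : ℂ) ≠ 0 := fun h0 => hx (by
          have := congrArg Complex.re h0
          simp at this
          linarith)
        have hc : ContinuousWithinAt f {z | 0 ≤ z.im} (x + ζ * Complex.I) := by
          refine (hf.continuousOn _ ⟨by simpa using hζ, hx0⟩).mono_of_mem_nhdsWithin ?_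
          exact inter_mem_nhdsWithin _ (isOpen_compl_singleton.mem_nhds hx0)
        refine ContinuousWithinAt.comp (t := {z | 0 ≤ z.im}) hc (by fun_prop) ?_
        intro w hw
        simpa using hw
  refine PhragmenLindelof.right_half_plane_of_bounded_on_real (f := G) (z := y) hdc
    ⟨0, by norm_num, 0, ?_⟩ ?_ ?_ (by simpa using hy)
  · refine Asymptotics.IsBigO.of_bound (∫ x, K * ‖g x‖) ?_
    refine eventually_inf_principal.mpr (Eventually.of_forall fun ζ hζ => ?_)
    simpa using hGb ζ (le_of_lt hζ)
  · refine isBoundedUnder_of_eventually_le (a := ∫ x, K * ‖g x‖) ?_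
    filter_upwards [eventually_ge_atTop 0] with x hx using hGb x (by simpa using hx)
  · intro t
    have := hA (-t)
    simp only [hG]
    have hI : ∀ x : ℝ, (x + t * Complex.I * Complex.I : ℂ) = x + ((-t : ℝ) : ℂ) := fun x => by
      rw [mul_assoc, Complex.I_mul_I]
      push_cast
      ring
    simpa only [hI] using this

/-- The `p`-th power mean over a horizontal line is at most the one over the real line. -/
theorem lintegral_line_le (hf : BoundedUpToBoundary f K) {p : ℝ} (hp : 1 < p) {y : ℝ}
    (hy : 0 < y) :
    ∫⁻ x : ℝ, ‖f (x + y * Complex.I)‖ₑ ^ p ≤ ∫⁻ x : ℝ, ‖f x‖ₑ ^ p := by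
  set A := ∫⁻ x : ℝ, ‖f x‖ₑ ^ p with hAdef
  rcases eq_or_ne A ∞ with hA | hA
  · rw [hA]; exact le_top
  have hp0 : 0 < p := by linarith
  -- Restricting to compact intervals makes the left side finite, so that a power of it can be
  -- cancelled at the end.
  have hmono : Monotone fun n : ℕ => Icc (-(n : ℝ)) n := fun m n hmn =>
    Icc_subset_Icc (neg_le_neg (Nat.cast_le.mpr hmn)) (Nat.cast_le.mpr hmn)
  have hun : ⋃ n : ℕ, Icc (-(n : ℝ)) n = univ := by
    refine eq_univ_of_forall fun x => ?_
    obtain ⟨n, hn⟩ := exists_nat_ge |x|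
    exact mem_iUnion.mpr ⟨n, abs_le.mp hn⟩
  rw [← setLIntegral_univ, ← hun, setLIntegral_iUnion_of_directed _ hmono.directed_le]
  refine iSup_le fun n => ?_
  set S := Icc (-(n : ℝ)) n with hS
  set φ : ℝ → ℂ := fun x => f (x + y * Complex.I) with hφ
  have hφc : Continuous φ := hf.continuous_line hy
  set B := ∫⁻ x in S, ‖φ x‖ₑ ^ p with hB
  have hBi : IntegrableOn (fun x => ‖φ x‖ ^ p) S :=
    ((hφc.norm.rpow_const fun _ => Or.inr hp0.le).continuousOn).integrableOn_compact isCompact_Icc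
  have hpow : ∀ x, ‖φ x‖ₑ ^ p = ‖‖φ x‖ ^ p‖ₑ := fun x => by
    rw [Real.enorm_rpow_of_nonneg (norm_nonneg _) hp0.le, enorm_norm]
  have hBtop : B ≠ ∞ := by
    have := hBi.2
    rw [hasFiniteIntegral_iff_enorm] at this
    simp only [hB, hpow]
    exact this.ne
  -- The extremal function of L^p–L^q duality: φg = |φ|^p and |g|^q = |φ|^p on S.
  set g : ℝ → ℂ := S.indicator fun x => (starRingEnd ℂ) (φ x) * ((‖φ x‖ ^ (p - 2) : ℝ) : ℂ) with hg
  have hgn : ∀ x, ‖g x‖ₑ = S.indicator (fun x => ‖φ x‖ₑ ^ (p - 1)) x := by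
    intro x
    rw [hg, enorm_indicator_eq_indicator_enorm]
    congr 1
    funext x
    rcases eq_or_ne (φ x) 0 with h0 | h0
    · simp [h0, ENNReal.zero_rpow_of_pos (show 0 < p - 1 by linarith)]
    · have hpos : 0 < ‖φ x‖ := norm_pos_iff.mpr h0
      rw [← ofReal_norm, ← ofReal_norm, ENNReal.ofReal_rpow_of_pos hpos, norm_mul, RCLike.norm_conj,
        Complex.norm_real, Real.norm_of_nonneg (by positivity)]
      congr 1
      rw [← Real.rpow_one_add' hpos.le (by linarith)]
      congr 1
      ring
  have hgmeas : AEStronglyMeasurable g := by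
    refine AEStronglyMeasurable.indicator ?_ measurableSet_Icc
    refine (Complex.continuous_conj.comp hφc).aestronglyMeasurable.mul ?_
    exact (Complex.measurable_ofReal.comp
      (hφc.measurable.norm.pow_const (p - 2))).aestronglyMeasurable
  have hgi : Integrable g := by
    refine ⟨hgmeas, ?_⟩
    rw [hasFiniteIntegral_iff_enorm]
    simp only [hgn]
    rw [lintegral_indicator measurableSet_Icc]
    have h1 : IntegrableOn (fun x => ‖φ x‖ ^ (p - 1)) S :=
      ((hφc.norm.rpow_const fun _ => Or.inr (by linarith)).continuousOn).integrableOn_compact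
        isCompact_Icc
    have h2 := h1.2
    rw [hasFiniteIntegral_iff_enorm] at h2
    refine lt_of_eq_of_lt (lintegral_congr fun x => ?_) h2
    rw [Real.enorm_rpow_of_nonneg (norm_nonneg _) (by linarith), enorm_norm]
  have hfg : ∫ x : ℝ, f (x + y * Complex.I) * g x = ((∫ x in S, ‖φ x‖ ^ p : ℝ) : ℂ) := by
    rw [← integral_complex_ofReal, ← integral_indicator measurableSet_Icc]
    congr 1
    funext x
    by_cases hx : x ∈ S
    · rw [hg, indicator_of_mem hx, indicator_of_mem hx]
      change φ x * _ = _
      rcases eq_or_ne (φ x) 0 with h0 | h0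
      · simp [h0, Real.zero_rpow hp0.ne']
      · rw [← mul_assoc, Complex.mul_conj, ← Complex.ofReal_mul, Complex.normSq_eq_norm_sq,
          ← Real.rpow_natCast, ← Real.rpow_add (norm_pos_iff.mpr h0)]
        congr 2
        push_cast
        ring
    · rw [hg, indicator_of_notMem hx, indicator_of_notMem hx, mul_zero]
  have hBeq : B = ENNReal.ofReal (∫ x in S, ‖φ x‖ ^ p) := by
    rw [ofReal_integral_eq_lintegral_ofReal hBi (ae_of_all _ fun x => by positivity)]
    refine lintegral_congr fun x => ?_
    rw [hpow, Real.enorm_of_nonneg (by positivity)]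
  have hpq : p.HolderConjugate p.conjExponent := Real.HolderConjugate.conjExponent hp
  set q := p.conjExponent with hq
  have hqp : (p - 1) * q = p := by
    rw [hq, Real.conjExponent, mul_div_cancel₀ _ (sub_pos.mpr hp).ne']
  have hq1 : 1 / q = 1 - 1 / p := by
    have := hpq.inv_add_inv_eq_one
    rw [one_div, one_div]
    linarith
  have hgq : ∫⁻ x, ‖g x‖ₑ ^ q = B := by
    rw [hB, ← lintegral_indicator measurableSet_Icc]
    refine lintegral_congr fun x => ?_
    rw [hgn]
    by_cases hx : x ∈ S
    · rw [indicator_of_mem hx, indicator_of_mem hx, ← ENNReal.rpow_mul, hqp]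
    · rw [indicator_of_notMem hx, indicator_of_notMem hx, ENNReal.zero_rpow_of_pos hpq.symm.pos]
  have hreal : ∀ t : ℝ, ‖∫ x : ℝ, f (x + t) * g x‖ ≤ (A ^ (1 / p) * B ^ (1 / q)).toReal := by
    intro t
    have h1 : ‖∫ x : ℝ, f (x + t) * g x‖ₑ ≤ A ^ (1 / p) * B ^ (1 / q) := by
      refine (enorm_integral_le_lintegral_enorm _).trans ?_
      simp only [enorm_mul]
      refine (ENNReal.lintegral_mul_le_Lp_mul_Lq volume hpq
        (hf.aestronglyMeasurable_line (ζ := t) (by simp)).enorm hgmeas.enorm).trans (le_of_eq ?_)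
      rw [hgq]
      congr 2
      have := lintegral_add_right_eq_self (μ := (volume : Measure ℝ)) (fun x : ℝ => ‖f x‖ₑ ^ p) t
      rw [hAdef, ← this]
      simp
    have h2 : A ^ (1 / p) * B ^ (1 / q) ≠ ∞ := by
      refine ENNReal.mul_ne_top (ENNReal.rpow_ne_top_of_nonneg (by positivity) hA)
        (ENNReal.rpow_ne_top_of_nonneg ?_ hBtop)
      exact one_div_nonneg.mpr hpq.symm.pos.le
    rw [← toReal_enorm]
    exact ENNReal.toReal_mono h2 h1
  have hmain := hf.norm_integral_mul_le hgi hreal hy.le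
  rw [hfg, Complex.norm_real, Real.norm_of_nonneg (integral_nonneg fun x => by positivity)] at hmain
  have hmain' : B ≤ A ^ (1 / p) * B ^ (1 / q) := by
    rw [hBeq]
    rw [hBeq] at hmain
    exact ENNReal.ofReal_le_of_le_toReal hmain
  rcases eq_or_ne B 0 with hB0 | hB0
  · rw [hB0]; exact bot_le
  have h1 : B ^ (1 / p) * B ^ (1 / q) ≤ A ^ (1 / p) * B ^ (1 / q) := by
    rw [← ENNReal.rpow_add _ _ hB0 hBtop, hq1, add_sub_cancel, ENNReal.rpow_one, ← hq1]
    exact hmain'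
  have h2 : B ^ (1 / p) ≤ A ^ (1 / p) :=
    (ENNReal.mul_le_mul_iff_left (by simp [hB0, hBtop]) (ENNReal.rpow_ne_top_of_nonneg
      (one_div_nonneg.mpr hpq.symm.pos.le) hBtop)).mp h1
  exact (ENNReal.rpow_le_rpow_iff (by positivity)).mp h2

/-- The Hardy norm is the `L^p` norm of the boundary values. -/
theorem hardyENorm_eq (hf : BoundedUpToBoundary f K) {p : ℝ} (hp : 1 < p) :
    hardyENorm p (fun z : ℍ => f z) = (∫⁻ x : ℝ, ‖f x‖ₑ ^ p) ^ (1 / p) := by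
  have hp0 : 0 < p := by linarith
  have hpe : ENNReal.ofReal p ≠ 0 := by simpa using hp0
  have hbd : eLpNorm (fun x : ℝ => f x) (ENNReal.ofReal p) volume =
      (∫⁻ x : ℝ, ‖f x‖ₑ ^ p) ^ (1 / p) := by
    rw [eLpNorm_eq_lintegral_rpow_enorm_toReal hpe ENNReal.ofReal_ne_top,
      ENNReal.toReal_ofReal hp0.le]
  have hmk : ∀ (x : ℝ) (y : Ioi (0 : ℝ)),
      (⟨x, y⟩ : ℂ) = x + (y : ℝ) * Complex.I := fun x y => by
    apply Complex.ext <;> simp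
  unfold hardyENorm
  simp only [hmk]
  refine le_antisymm (iSup_le fun y => ?_) ?_
  · rw [eLpNorm_eq_lintegral_rpow_enorm_toReal hpe ENNReal.ofReal_ne_top,
      ENNReal.toReal_ofReal hp0.le]
    exact ENNReal.rpow_le_rpow (hf.lintegral_line_le hp y.2) (by positivity)
  · rw [← hbd]
    -- Fatou's lemma along heights decreasing to 0; the boundary values are limits except perhaps at
    -- x = 0.
    let u : ℕ → Ioi (0 : ℝ) := fun n => ⟨1 / ((n : ℝ) + 1), mem_Ioi.mpr Nat.one_div_pos_of_nat⟩
    refine (Lp.eLpNorm_lim_le_liminf_eLpNorm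
      (f := fun n (x : ℝ) => f (x + (u n : ℝ) * Complex.I))
      (fun n => (hf.continuous_line (u n).2).aestronglyMeasurable) _ ?_).trans ?_
    · have hne : ∀ᵐ x : ℝ, x ≠ 0 := by simp [ae_iff, measure_singleton]
      filter_upwards [hne] with x hx
      have hc := hf.continuousOn x ⟨by simp, by simpa using hx⟩
      have hu : Tendsto (fun n => (x + (u n : ℝ) * Complex.I : ℂ)) atTop (𝓝 x) := by
        have h1 : Tendsto (fun n => (u n : ℝ)) atTop (𝓝 0) := tendsto_one_div_add_atTop_nhds_zero_nat
        have h2 := ((Complex.continuous_ofReal.tendsto 0).comp h1).mul_const Complex.I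
        simpa using h2.const_add (x : ℂ)
      refine hc.tendsto.comp (tendsto_nhdsWithin_iff.mpr ⟨hu, Eventually.of_forall fun n => ⟨?_, ?_⟩⟩)
      · simpa using (u n).2.le
      · intro h0
        have := congrArg Complex.im h0
        have h3 := (u n).2
        simp only [Complex.add_im, Complex.ofReal_im, Complex.mul_im, Complex.ofReal_re,
          Complex.I_im, Complex.I_re, Complex.zero_im, mul_one, mul_zero, add_zero, zero_add]
          at this
        rw [this] at h3
        exact lt_irrefl _ (mem_Ioi.mp h3)
    · refine liminf_le_of_le (by isBoundedDefault) fun b hb => ?_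
      obtain ⟨n, hn⟩ := hb.exists
      exact hn.trans (le_iSup (fun y : Ioi (0 : ℝ) =>
        eLpNorm (fun x : ℝ => f (x + (y : ℝ) * Complex.I)) (ENNReal.ofReal p) volume) (u n))

end BoundedUpToBoundary

/-! ### Hardy's inequality and the boundedness of C -/

theorem isOpen_im_pos : IsOpen {z : ℂ | 0 < z.im} :=
  isOpen_lt continuous_const Complex.continuous_im

theorem lintegral_Ioc_rpow_lt_top {p : ℝ} (hp : 1 < p) :
    ∫⁻ t in Ioc (0 : ℝ) 1, ENNReal.ofReal t ^ (-1 / p) < ∞ := by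
  have h1 : -1 < -1 / p := by
    rw [neg_div, neg_lt_neg_iff, div_lt_one (by linarith)]
    exact hp
  have h2 := (intervalIntegral.intervalIntegrable_rpow' (a := 0) (b := 1) h1).1.2
  rw [hasFiniteIntegral_iff_enorm] at h2
  refine lt_of_eq_of_lt (setLIntegral_congr_fun measurableSet_Ioc fun t ht => ?_) h2
  change ENNReal.ofReal t ^ (-1 / p) = ‖t ^ (-1 / p)‖ₑ
  rw [Real.enorm_of_nonneg (Real.rpow_nonneg ht.1.le _), ENNReal.ofReal_rpow_of_pos ht.1]

/-- The weighted Hölder inequality behind Hardy's inequality. -/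
theorem rpow_lintegral_Ioc_le {p : ℝ} (hp : 1 < p) {φ : ℝ → ℝ≥0∞}
    (hφ : AEMeasurable φ (volume.restrict (Ioc 0 1))) :
    (∫⁻ t in Ioc (0 : ℝ) 1, φ t) ^ p ≤
      (∫⁻ t in Ioc (0 : ℝ) 1, ENNReal.ofReal t ^ (-1 / p)) ^ (p - 1) *
        ∫⁻ t in Ioc (0 : ℝ) 1, ENNReal.ofReal t ^ (1 - 1 / p) * φ t ^ p := by
  have hp0 : 0 < p := by linarith
  have hpq : p.HolderConjugate p.conjExponent := Real.HolderConjugate.conjExponent hp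
  set q := p.conjExponent with hq
  have hq0 := hpq.symm.pos
  have hq1 : 1 / q = 1 - 1 / p := by
    have := hpq.inv_add_inv_eq_one
    rw [one_div, one_div]
    linarith
  have hqp : p / q = p - 1 := by
    rw [div_eq_mul_one_div, hq1]
    field_simp
  have hω : Measurable fun t : ℝ => ENNReal.ofReal t := ENNReal.measurable_ofReal
  -- The weight t^{1/(pq)} becomes t^{1/q} = t^{1 - 1/p} in the p-th power, and its inverse becomes
  -- t^{-1/p} in the q-th power.
  have h1 : ∫⁻ t in Ioc (0 : ℝ) 1, φ t =
      ∫⁻ t in Ioc (0 : ℝ) 1, ((fun t => ENNReal.ofReal t ^ (1 / (p * q)) * φ t) *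
        fun t => ENNReal.ofReal t ^ (-(1 / (p * q)))) t := by
    refine setLIntegral_congr_fun measurableSet_Ioc fun t ht => ?_
    have ht0 : ENNReal.ofReal t ≠ 0 := by simpa using ht.1
    simp only [Pi.mul_apply]
    rw [mul_comm, ← mul_assoc, ← ENNReal.rpow_add _ _ ht0 ENNReal.ofReal_ne_top, neg_add_cancel,
      ENNReal.rpow_zero, one_mul]
  have h2 := ENNReal.lintegral_mul_le_Lp_mul_Lq (volume.restrict (Ioc (0 : ℝ) 1)) hpq
    ((hω.pow_const (1 / (p * q))).aemeasurable.mul hφ)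
    (hω.pow_const (-(1 / (p * q)))).aemeasurable
  rw [h1]
  refine (ENNReal.rpow_le_rpow h2 hp0.le).trans (le_of_eq ?_)
  rw [ENNReal.mul_rpow_of_nonneg _ _ hp0.le, ← ENNReal.rpow_mul, ← ENNReal.rpow_mul,
    one_div_mul_cancel hp0.ne', ENNReal.rpow_one, mul_comm, one_div_mul_eq_div, hqp]
  congr 1
  · congr 1
    refine lintegral_congr fun t => ?_
    rw [← ENNReal.rpow_mul]
    congr 1
    field_simp
  · refine lintegral_congr fun t => ?_
    rw [Pi.mul_apply, ENNReal.mul_rpow_of_nonneg _ _ hp0.le, ← ENNReal.rpow_mul, ← hq1]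
    congr 2
    field_simp

namespace HardySpace

variable {p : ℝ} [hp : Fact (1 < p)]

/-- An element of `H^p` as a function on `ℂ`; its values off the upper half-plane play no role. -/
noncomputable def onComplex (f : HardySpace p) : ℂ → ℂ := f.toFun ∘ ofComplex

theorem onComplex_coe (f : HardySpace p) (z : ℍ) : f.onComplex z = f z := by
  simp [onComplex]

theorem differentiableOn_onComplex (f : HardySpace p) :
    DifferentiableOn ℂ f.onComplex {z | 0 < z.im} :=
  UpperHalfPlane.mdifferentiable_iff.mp f.2.1

theorem exists_norm_onComplex_le (f : HardySpace p) :
    ∃ K : ℝ, 0 ≤ K ∧ ∀ z : ℂ, 0 < z.im → ‖f.onComplex z‖ ≤ K * z.im ^ (-1 / p) := by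
  obtain ⟨K, hK, h⟩ := exists_norm_le_im_rpow f
  refine ⟨K, hK, fun z hz => ?_⟩
  have := h ⟨z, hz⟩
  rwa [← onComplex_coe] at this

theorem norm_onComplex_mul_le {f : HardySpace p} {K : ℝ} (hK : 0 ≤ K)
    (h : ∀ z : ℂ, 0 < z.im → ‖f.onComplex z‖ ≤ K * z.im ^ (-1 / p)) {z : ℂ} {η : ℝ} (hη : 0 < η)
    (hz : η ≤ z.im) {t : ℝ} (ht : 0 < t) :
    ‖f.onComplex (t * z)‖ ≤ K * η ^ (-1 / p) * t ^ (-1 / p) := by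
  have hp0 : 0 < p := zero_lt_one.trans hp.out
  have him : (t * z : ℂ).im = t * z.im := by simp
  refine (h _ (by rw [him]; exact mul_pos ht (hη.trans_le hz))).trans ?_
  rw [him, Real.mul_rpow ht.le (hη.le.trans hz), mul_comm (t ^ _), ← mul_assoc]
  gcongr ?_ * _
  gcongr K * ?_
  exact Real.rpow_le_rpow_of_nonpos hη hz (by rw [neg_div]; simpa using hp0.le)

theorem continuousOn_onComplex_mul (f : HardySpace p) {z : ℂ} (hz : 0 < z.im) :
    ContinuousOn (fun t : ℝ => f.onComplex (t * z)) (Ioc 0 1) := by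
  refine f.differentiableOn_onComplex.continuousOn.comp (by fun_prop) fun t ht => ?_
  simpa using mul_pos ht.1 hz

theorem integrableOn_Ioc_rpow : IntegrableOn (fun t : ℝ => t ^ (-1 / p)) (Ioc 0 1) := by
  have h1 : -1 < -1 / p := by
    rw [neg_div, neg_lt_neg_iff, div_lt_one (zero_lt_one.trans hp.out)]
    exact hp.out
  exact (intervalIntegral.intervalIntegrable_rpow' (a := 0) (b := 1) h1).1

theorem integrableOn_onComplex_mul (f : HardySpace p) {z : ℂ} (hz : 0 < z.im) :
    IntegrableOn (fun t : ℝ => f.onComplex (t * z)) (Ioc 0 1) := by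
  obtain ⟨K, hK, h⟩ := f.exists_norm_onComplex_le
  refine (integrableOn_Ioc_rpow (p := p).const_mul (K * z.im ^ (-1 / p))).mono'
    ((f.continuousOn_onComplex_mul hz).aestronglyMeasurable measurableSet_Ioc) ?_
  filter_upwards [ae_restrict_mem measurableSet_Ioc] with t ht
  exact norm_onComplex_mul_le hK h hz le_rfl ht.1

theorem intervalIntegrable_segmentIntegrand (f : HardySpace p) (z : ℍ) :
    IntervalIntegrable (segmentIntegrand f z) volume 0 1 := by
  rw [intervalIntegrable_iff_integrableOn_Ioc_of_le zero_le_one]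
  exact (f.integrableOn_onComplex_mul z.im_pos).mul_const (z : ℂ)

theorem cesaro_eq (f : HardySpace p) (z : ℍ) :
    cesaro f z = ∫ t in Ioc (0 : ℝ) 1, f.onComplex (t * z) := by
  rw [cesaro, intervalIntegral.integral_of_le zero_le_one]
  change 1 / (z : ℂ) * ∫ t in Ioc (0 : ℝ) 1, f.onComplex (t * z) * (z : ℂ) = _
  rw [integral_mul_const]
  field_simp [UpperHalfPlane.ne_zero z]

theorem mdifferentiable_cesaro (f : HardySpace p) : MDifferentiable 𝓘(ℂ) 𝓘(ℂ) (cesaro f) := by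
  rw [UpperHalfPlane.mdifferentiable_iff]
  obtain ⟨K, hK, h⟩ := f.exists_norm_onComplex_le
  have hmain : DifferentiableOn ℂ (fun z => ∫ t in Ioc (0 : ℝ) 1, f.onComplex (t * z))
      {z | 0 < z.im} := by
    refine differentiableOn_integral_of_dominated isOpen_im_pos
      (fun z hz => (f.integrableOn_onComplex_mul hz).1) ?_ fun z hz => ?_
    · filter_upwards [ae_restrict_mem measurableSet_Ioc] with t ht
      refine f.differentiableOn_onComplex.comp (by fun_prop) fun z hz => ?_
      simpa using mul_pos ht.1 hz
    · have hz0 : 0 < z.im := hz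
      refine ⟨z.im / 2, half_pos hz0, _,
        integrableOn_Ioc_rpow (p := p).const_mul (K * (z.im / 2) ^ (-1 / p)), ?_⟩
      filter_upwards [ae_restrict_mem measurableSet_Ioc] with t ht w hw
      refine norm_onComplex_mul_le hK h (half_pos hz0) ?_ ht.1
      rw [mem_ball_iff_norm] at hw
      have h1 := (Complex.abs_im_le_norm (w - z)).trans_lt hw
      rw [Complex.sub_im, abs_lt] at h1
      linarith
  refine hmain.congr fun z hz => ?_
  rw [Function.comp_apply, cesaro_eq, ofComplex_apply_of_im_pos hz]

theorem lintegral_onComplex_line_le (f : HardySpace p) {y : ℝ} (hy : 0 < y) :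
    ∫⁻ x : ℝ, ‖f.onComplex (x + y * Complex.I)‖ₑ ^ p ≤ hardyENorm p f ^ p := by
  have hp0 : 0 < p := zero_lt_one.trans hp.out
  have h1 : eLpNorm (fun x : ℝ => f.onComplex (x + y * Complex.I)) (ENNReal.ofReal p) volume ≤
      hardyENorm p f := by
    refine le_trans (le_of_eq ?_) (le_iSup _ (⟨y, hy⟩ : Ioi (0 : ℝ)))
    congr 1
    funext x
    rw [onComplex, Function.comp_apply, ofComplex_apply_of_im_pos (by simpa using hy)]
    congr 1
    ext1
    apply Complex.ext <;> simp
  rw [eLpNorm_eq_lintegral_rpow_enorm_toReal (by simpa using hp0) ENNReal.ofReal_ne_top,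
    ENNReal.toReal_ofReal hp0.le] at h1
  have h2 := ENNReal.rpow_le_rpow h1 hp0.le
  rwa [← ENNReal.rpow_mul, one_div_mul_cancel hp0.ne', ENNReal.rpow_one] at h2

/-- The substitution x ↦ tx costs 1/t and moves the line to height ty; the Hardy norm bounds all
heights alike. -/
theorem lintegral_onComplex_dilation_le (f : HardySpace p) {y t : ℝ} (hy : 0 < y) (ht : 0 < t) :
    ∫⁻ x : ℝ, ‖f.onComplex (t * (x + y * Complex.I))‖ₑ ^ p ≤
      ENNReal.ofReal t ^ (-1 : ℝ) * hardyENorm p f ^ p := by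
  have hty := mul_pos ht hy
  set φ : ℝ → ℝ≥0∞ := fun x => ‖f.onComplex (x + (t * y : ℝ) * Complex.I)‖ₑ ^ p with hφ
  have hφm : Measurable φ := by
    have : Continuous fun x : ℝ => f.onComplex (x + (t * y : ℝ) * Complex.I) := by
      refine f.differentiableOn_onComplex.continuousOn.comp_continuous (by fun_prop) fun x => ?_
      simpa using hty
    exact this.measurable.enorm.pow_const p
  have h1 : ∀ x : ℝ, ‖f.onComplex (t * (x + y * Complex.I))‖ₑ ^ p = φ (t * x) := fun x => by
    simp only [hφ]
    congr 3
    push_cast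
    ring
  simp only [h1]
  rw [← lintegral_map hφm (measurable_const_mul t), Real.map_volume_mul_left ht.ne',
    lintegral_smul_measure, abs_of_pos (inv_pos.mpr ht), ENNReal.ofReal_inv_of_pos ht,
    ENNReal.rpow_neg_one, smul_eq_mul]
  gcongr
  exact f.lintegral_onComplex_line_le hty

/-- Hardy's inequality. -/
theorem hardyENorm_cesaro_le (f : HardySpace p) :
    hardyENorm p (cesaro f) ≤
      (∫⁻ t in Ioc (0 : ℝ) 1, ENNReal.ofReal t ^ (-1 / p)) * hardyENorm p f := by
  have hp1 : 1 < p := hp.out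
  have hp0 : 0 < p := zero_lt_one.trans hp.out
  set c := ∫⁻ t in Ioc (0 : ℝ) 1, ENNReal.ofReal t ^ (-1 / p) with hc
  set M := hardyENorm p f with hM
  have hMtop : M ≠ ∞ := f.2.2.ne
  refine iSup_le fun y => ?_
  have hy : (0 : ℝ) < y := y.2
  rw [eLpNorm_eq_lintegral_rpow_enorm_toReal (by simpa using hp0) ENNReal.ofReal_ne_top,
    ENNReal.toReal_ofReal hp0.le]
  rw [one_div, ENNReal.rpow_inv_le_iff hp0]
  have hcont : ContinuousOn (fun q : ℝ × ℝ => f.onComplex (q.2 * (q.1 + (y : ℝ) * Complex.I)))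
      (univ ×ˢ Ioc (0 : ℝ) 1) := by
    refine f.differentiableOn_onComplex.continuousOn.comp (by fun_prop) ?_
    rintro ⟨x, t⟩ ⟨-, ht⟩
    simpa using mul_pos ht.1 hy
  have hmeas : AEMeasurable (fun q : ℝ × ℝ => ENNReal.ofReal q.2 ^ (1 - 1 / p) *
      ‖f.onComplex (q.2 * (q.1 + (y : ℝ) * Complex.I))‖ₑ ^ p)
      (volume.prod (volume.restrict (Ioc (0 : ℝ) 1))) := by
    have h1 : AEMeasurable (fun q : ℝ × ℝ => f.onComplex (q.2 * (q.1 + (y : ℝ) * Complex.I)))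
        (volume.prod (volume.restrict (Ioc (0 : ℝ) 1))) := by
      have := hcont.aemeasurable (μ := volume) (MeasurableSet.univ.prod measurableSet_Ioc)
      rwa [Measure.volume_eq_prod, ← Measure.prod_restrict, Measure.restrict_univ] at this
    exact ((ENNReal.measurable_ofReal.comp measurable_snd).pow_const _).aemeasurable.mul
      (h1.enorm.pow_const p)
  -- Weighted Hölder followed by Tonelli takes the place of Minkowski's integral inequality and
  -- yields the same constant c, the integral of t^{-1/p}.
  calc ∫⁻ x : ℝ, ‖cesaro f ⟨⟨x, y⟩, y.2⟩‖ₑ ^ p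
      ≤ ∫⁻ x : ℝ, c ^ (p - 1) * ∫⁻ t in Ioc (0 : ℝ) 1, ENNReal.ofReal t ^ (1 - 1 / p) *
          ‖f.onComplex (t * (x + (y : ℝ) * Complex.I))‖ₑ ^ p := by
        refine lintegral_mono fun x => ?_
        have hxy : (⟨x, y⟩ : ℂ) = x + (y : ℝ) * Complex.I := by apply Complex.ext <;> simp
        have him : 0 < (x + (y : ℝ) * Complex.I : ℂ).im := by simpa using hy
        rw [cesaro_eq]
        simp only [hxy]
        exact (ENNReal.rpow_le_rpow (enorm_integral_le_lintegral_enorm _) hp0.le).trans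
          (rpow_lintegral_Ioc_le hp1 (f.integrableOn_onComplex_mul him).1.enorm)
    _ = c ^ (p - 1) * ∫⁻ t in Ioc (0 : ℝ) 1, ∫⁻ x : ℝ, ENNReal.ofReal t ^ (1 - 1 / p) *
          ‖f.onComplex (t * (x + (y : ℝ) * Complex.I))‖ₑ ^ p := by
        rw [lintegral_const_mul' _ _ (ENNReal.rpow_ne_top_of_nonneg (by linarith)
          (lintegral_Ioc_rpow_lt_top hp1).ne), lintegral_lintegral_swap hmeas]
    _ ≤ c ^ (p - 1) * ∫⁻ t in Ioc (0 : ℝ) 1, ENNReal.ofReal t ^ (-1 / p) * M ^ p := by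
        refine mul_le_mul' le_rfl (setLIntegral_mono' measurableSet_Ioc fun t ht => ?_)
        have ht0 : ENNReal.ofReal t ≠ 0 := by simpa using ht.1
        rw [lintegral_const_mul' _ _ (by
          rw [ENNReal.ofReal_rpow_of_pos ht.1]; exact ENNReal.ofReal_ne_top)]
        refine (mul_le_mul' le_rfl (f.lintegral_onComplex_dilation_le hy ht.1)).trans (le_of_eq ?_)
        rw [← mul_assoc, ← ENNReal.rpow_add _ _ ht0 ENNReal.ofReal_ne_top]
        congr 2
        ring
    _ = (c * M) ^ p := by
        rw [lintegral_mul_const' _ _ (ENNReal.rpow_ne_top_of_nonneg hp0.le hMtop), ← hc,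
          ENNReal.mul_rpow_of_nonneg _ _ hp0.le, ← mul_assoc]
        congr 1
        conv_lhs => rw [← ENNReal.rpow_one c, ← ENNReal.rpow_mul, one_mul]
        rw [← ENNReal.rpow_add_of_nonneg _ _ (by linarith) zero_le_one, sub_add_cancel]

/-- The function `Cf` as an element of `H^p`. -/
noncomputable def cesaroFun (f : HardySpace p) : HardySpace p :=
  ⟨cesaro f, f.mdifferentiable_cesaro, f.hardyENorm_cesaro_le.trans_lt
    (ENNReal.mul_lt_top (lintegral_Ioc_rpow_lt_top hp.out) f.2.2)⟩

theorem ext {f g : HardySpace p} (h : ∀ z : ℍ, f z = g z) : f = g := Subtype.ext (funext h)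

/-- The Cesàro operator on `H^p`. -/
noncomputable def cesaroCLM : HardySpace p →L[ℂ] HardySpace p :=
  LinearMap.mkContinuous
    { toFun := cesaroFun
      map_add' := fun f g => HardySpace.ext fun z => by
        change cesaro (f + g : HardySpace p) z = cesaro f z + cesaro g z
        rw [cesaro_eq, cesaro_eq, cesaro_eq, ← integral_add
          (f.integrableOn_onComplex_mul z.im_pos) (g.integrableOn_onComplex_mul z.im_pos)]
        rfl
      map_smul' := fun c f => HardySpace.ext fun z => by
        change cesaro (c • f : HardySpace p) z = c * cesaro f z
        rw [cesaro_eq, cesaro_eq, ← integral_const_mul]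
        rfl }
    (∫⁻ t in Ioc (0 : ℝ) 1, ENNReal.ofReal t ^ (-1 / p)).toReal fun f => by
      change (hardyENorm p (cesaro f)).toReal ≤ _ * (hardyENorm p f).toReal
      rw [← ENNReal.toReal_mul]
      exact ENNReal.toReal_mono (ENNReal.mul_lt_top (lintegral_Ioc_rpow_lt_top hp.out) f.2.2).ne
        f.hardyENorm_cesaro_le

theorem cesaroCLM_apply (f : HardySpace p) (z : ℍ) : cesaroCLM f z = cesaro f z := rfl

end HardySpace

/-! ### Convexity and the comparison of Gaussian integrals -/

/-- Both x + d and y are convex combinations of x and y + d, with the two weights exchanged; adding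
the two convexity inequalities gives the claim. -/
theorem StrictConvexOn.map_add_add_lt {φ : ℝ → ℝ} (h : StrictConvexOn ℝ (Ici 0) φ) {x y d : ℝ}
    (hx : 0 ≤ x) (hxy : x < y) (hd : 0 < d) : φ (x + d) + φ y < φ x + φ (y + d) := by
  have hD : 0 < y + d - x := by linarith
  have hx' : x ∈ Ici (0 : ℝ) := hx
  have hy' : y + d ∈ Ici (0 : ℝ) := by
    rw [mem_Ici]
    linarith
  have hne : x ≠ y + d := by linarith
  have hs : (y - x) / (y + d - x) + d / (y + d - x) = 1 := by
    field_simp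
    ring
  have h1 := h.2 hx' hy' hne (div_pos (sub_pos.mpr hxy) hD) (div_pos hd hD) hs
  have h2 := h.2 hx' hy' hne (div_pos hd hD) (div_pos (sub_pos.mpr hxy) hD)
    (by rw [add_comm]; exact hs)
  have e1 : ((y - x) / (y + d - x)) • x + (d / (y + d - x)) • (y + d) = x + d := by
    simp only [smul_eq_mul]
    field_simp
    ring
  have e2 : (d / (y + d - x)) • x + ((y - x) / (y + d - x)) • (y + d) = y := by
    simp only [smul_eq_mul]
    field_simp
    ring
  rw [e1] at h1
  rw [e2] at h2
  simp only [smul_eq_mul] at h1 h2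
  have e3 : ∀ u v : ℝ, (y - x) / (y + d - x) * u + d / (y + d - x) * v +
      (d / (y + d - x) * u + (y - x) / (y + d - x) * v) = u + v := fun u v => by
    linear_combination (u + v) * hs
  linarith [e3 (φ x) (φ (y + d))]

/-- The sign by which the chirp of the extremal function has to turn. -/
noncomputable def chirpSign (p : ℝ) : ℝ := if 2 < p then -1 else 1

theorem chirpSign_mul_self (p : ℝ) : chirpSign p * chirpSign p = 1 := by
  unfold chirpSign
  split_ifs <;> norm_num

theorem rpow_add_rpow_lt {p a b s : ℝ} (hp : 0 < p) (hp2 : p ≠ 2) (ha : 0 < a) (hb : 0 < b)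
    (hs : s ≠ 0) :
    ((a - 2 * s) ^ 2 + (b - 2 * chirpSign p * s) ^ 2) ^ (p / 2) +
        ((a + 2 * s) ^ 2 + (b + 2 * chirpSign p * s) ^ 2) ^ (p / 2) <
      ((a + 2 * s) ^ 2 + (b - 2 * chirpSign p * s) ^ 2) ^ (p / 2) +
        ((a - 2 * s) ^ 2 + (b + 2 * chirpSign p * s) ^ 2) ^ (p / 2) := by
  wlog hs0 : 0 < s generalizing s
  · have h := this (s := -s) (neg_ne_zero.mpr hs) (by
      rcases lt_or_gt_of_ne hs with h | h
      · linarith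
      · exact absurd h hs0)
    simp only [mul_neg, sub_neg_eq_add, ← sub_eq_add_neg] at h
    linarith
  have has := mul_pos ha hs0
  have hbs := mul_pos hb hs0
  have hd : 0 < 8 * (a * s) := by linarith
  -- For s > 0 the pair with the smallest and the largest base is the ε = -1 pair if σ = 1 and the ε
  -- = 1 pair if σ = -1. The wider pair has the smaller sum under a concave power and the larger one
  -- under a convex power, whence the choice of `chirpSign`.
  rcases lt_or_gt_of_ne hp2 with h2 | h2
  · have hc : StrictConvexOn ℝ (Ici 0) (fun x : ℝ => -x ^ (p / 2)) :=
      (Real.strictConcaveOn_rpow (by linarith) (by linarith)).neg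
    have hσ : chirpSign p = 1 := if_neg (not_lt.mpr h2.le)
    rw [hσ]
    have h := hc.map_add_add_lt (x := (a - 2 * s) ^ 2 + (b - 2 * 1 * s) ^ 2)
      (y := (a - 2 * s) ^ 2 + (b + 2 * 1 * s) ^ 2) (by positivity) (by nlinarith) hd
    rw [show (a - 2 * s) ^ 2 + (b - 2 * 1 * s) ^ 2 + 8 * (a * s) =
        (a + 2 * s) ^ 2 + (b - 2 * 1 * s) ^ 2 by ring,
      show (a - 2 * s) ^ 2 + (b + 2 * 1 * s) ^ 2 + 8 * (a * s) =
        (a + 2 * s) ^ 2 + (b + 2 * 1 * s) ^ 2 by ring] at h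
    linarith
  · have hc : StrictConvexOn ℝ (Ici 0) (fun x : ℝ => x ^ (p / 2)) :=
      strictConvexOn_rpow (by linarith)
    have hσ : chirpSign p = -1 := if_pos h2
    rw [hσ]
    have h := hc.map_add_add_lt (x := (a - 2 * s) ^ 2 + (b + 2 * -1 * s) ^ 2)
      (y := (a - 2 * s) ^ 2 + (b - 2 * -1 * s) ^ 2) (by positivity) (by nlinarith) hd
    rw [show (a - 2 * s) ^ 2 + (b + 2 * -1 * s) ^ 2 + 8 * (a * s) =
        (a + 2 * s) ^ 2 + (b + 2 * -1 * s) ^ 2 by ring,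
      show (a - 2 * s) ^ 2 + (b - 2 * -1 * s) ^ 2 + 8 * (a * s) =
        (a + 2 * s) ^ 2 + (b - 2 * -1 * s) ^ 2 by ring] at h
    linarith

/-- The `p`-th power of the modulus of a linear function of `s` against a Gaussian. -/
noncomputable def gaussDensity (p a ε b : ℝ) (s : ℝ) : ℝ :=
  ((a + 2 * ε * s) ^ 2 + (b - 2 * chirpSign p * s) ^ 2) ^ (p / 2) * Real.exp (-p * s ^ 2)

theorem gaussDensity_nonneg (p a ε b s : ℝ) : 0 ≤ gaussDensity p a ε b s := by
  unfold gaussDensity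
  positivity

theorem continuous_gaussDensity {p : ℝ} (hp : 0 < p) (a ε b : ℝ) :
    Continuous (gaussDensity p a ε b) := by
  unfold gaussDensity
  refine Continuous.mul (Continuous.rpow_const (by fun_prop) fun _ => Or.inr (by positivity)) ?_
  fun_prop

theorem integrable_gaussDensity {p : ℝ} (hp : 0 < p) (a ε b : ℝ) :
    Integrable (gaussDensity p a ε b) := by
  -- From (x + y)² ≤ 2x² + 2y² the base is at most A(s² + 1) ≤ A e^{s²}; its power p/2 uses up only
  -- half of the Gaussian.
  set A : ℝ := 2 * a ^ 2 + 8 * ε ^ 2 + 2 * b ^ 2 + 8 * chirpSign p ^ 2 with hA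
  have hA0 : 0 ≤ A := by positivity
  refine ((integrable_exp_neg_mul_sq (half_pos hp)).const_mul (A ^ (p / 2))).mono'
    (continuous_gaussDensity hp a ε b).aestronglyMeasurable (ae_of_all _ fun s => ?_)
  rw [Real.norm_of_nonneg (gaussDensity_nonneg _ _ _ _ _), gaussDensity]
  have h1 : (a + 2 * ε * s) ^ 2 + (b - 2 * chirpSign p * s) ^ 2 ≤ A * Real.exp (s ^ 2) := by
    have h2 : (a + 2 * ε * s) ^ 2 + (b - 2 * chirpSign p * s) ^ 2 ≤ A * (s ^ 2 + 1) := by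
      have h3 : 0 ≤ (2 * a ^ 2 + 2 * b ^ 2) * s ^ 2 + 8 * ε ^ 2 + 8 * chirpSign p ^ 2 := by
        positivity
      nlinarith [sq_nonneg (a - 2 * ε * s), sq_nonneg (b + 2 * chirpSign p * s)]
    exact h2.trans (mul_le_mul_of_nonneg_left (Real.add_one_le_exp _) hA0)
  calc _ ≤ (A * Real.exp (s ^ 2)) ^ (p / 2) * Real.exp (-p * s ^ 2) := by
        gcongr
    _ = A ^ (p / 2) * Real.exp (-(p / 2) * s ^ 2) := by
        rw [Real.mul_rpow hA0 (Real.exp_pos _).le, mul_assoc, ← Real.exp_mul, ← Real.exp_add]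
        congr 2
        ring

/-- The difference of the integrands need not be positive pointwise, but its sum with its reflection
is positive off s = 0. -/
theorem integral_gaussDensity_lt {p a b : ℝ} (hp : 0 < p) (hp2 : p ≠ 2) (ha : 0 < a)
    (hb : 0 < b) : ∫ s, gaussDensity p a (-1) b s < ∫ s, gaussDensity p a 1 b s := by
  have hi := fun ε => integrable_gaussDensity hp a ε b
  set D : ℝ → ℝ := fun s => gaussDensity p a 1 b s - gaussDensity p a (-1) b s with hD
  have hDi : Integrable D := (hi 1).sub (hi (-1))
  have hpos : ∀ s ≠ 0, 0 < D s + D (-s) := by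
    intro s hs
    have h := rpow_add_rpow_lt hp hp2 ha hb hs
    have h2 := mul_lt_mul_of_pos_right h (Real.exp_pos (-p * s ^ 2))
    simp only [hD, gaussDensity, neg_sq]
    ring_nf at h2 ⊢
    linarith
  have hint : 0 < ∫ s, (D s + D (-s)) := by
    have hnn : ∀ s, 0 ≤ D s + D (-s) := by
      intro s
      rcases eq_or_ne s 0 with rfl | hs
      · simp [hD, gaussDensity]
      · exact (hpos s hs).le
    rw [integral_pos_iff_support_of_nonneg hnn (hDi.add hDi.comp_neg)]
    have hsub : Ioi (0 : ℝ) ⊆ Function.support fun s => D s + D (-s) := fun s hs =>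
      (hpos s (ne_of_gt hs)).ne'
    refine lt_of_lt_of_le ?_ (measure_mono hsub)
    simp
  rw [integral_add hDi hDi.comp_neg, integral_neg_eq_self, hD, integral_sub (hi 1) (hi (-1))] at hint
  linarith

theorem integral_gaussDensity_zero (p a : ℝ) :
    ∫ s, gaussDensity p a (-1) 0 s = ∫ s, gaussDensity p a 1 0 s := by
  rw [← integral_neg_eq_self]
  congr 1
  funext s
  simp only [gaussDensity]
  congr 2
  · ring
  · ring

/-! ### Chirped Gaussians in the logarithmic variable -/

/-- Logarithmic substitution on both half-lines. -/
theorem lintegral_eq_lintegral_exp (φ : ℝ → ℝ≥0∞) :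
    ∫⁻ x, φ x = (∫⁻ u, ENNReal.ofReal (Real.exp u) * φ (Real.exp u)) +
      ∫⁻ u, ENNReal.ofReal (Real.exp u) * φ (-Real.exp u) := by
  have h1 := lintegral_image_eq_lintegral_abs_deriv_mul MeasurableSet.univ
    (fun u _ => (Real.hasDerivAt_exp u).hasDerivWithinAt) Real.exp_injective.injOn φ
  have h2 := lintegral_image_eq_lintegral_abs_deriv_mul MeasurableSet.univ
    (fun u _ => (Real.hasDerivAt_exp u).neg.hasDerivWithinAt)
    (f := fun u => -Real.exp u) (neg_injective.comp Real.exp_injective).injOn φ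
  simp only [abs_neg, abs_of_pos (Real.exp_pos _), setLIntegral_univ] at h1 h2
  have e1 : Real.exp '' univ = Ioi 0 := by rw [image_univ, Real.range_exp]
  have e2 : (fun u => -Real.exp u) '' univ = Iio 0 := by
    rw [show (fun u => -Real.exp u) = Neg.neg ∘ Real.exp from rfl, image_comp, e1]
    simp
  rw [e1] at h1
  rw [e2] at h2
  rw [← h1, ← h2, ← lintegral_add_compl φ (measurableSet_Ioi (a := (0 : ℝ))), compl_Ioi,
    setLIntegral_congr Iio_ae_eq_Iic.symm]

/-- The logarithm on the closed upper half-plane that is real on the positive imaginary axis. -/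
noncomputable def rotLog (z : ℂ) : ℂ := Complex.log (-Complex.I * z)

/-- The exponent of a chirped Gaussian in the logarithmic variable. -/
noncomputable def chirpExponent (p : ℝ) (L : ℂ) : ℂ :=
  -(1 + chirpSign p * Complex.I) * L ^ 2 + (2 * Real.pi * Complex.I - 1 / p) * L

/-- A chirped Gaussian of the logarithm, multiplied by a linear function of the logarithm. -/
noncomputable def logChirp (p : ℝ) (c₀ c₁ : ℂ) (z : ℂ) : ℂ :=
  (c₀ + c₁ * rotLog z) * Complex.exp (chirpExponent p (rotLog z))

theorem mem_slitPlane_of_im_nonneg {z : ℂ} (hz : 0 ≤ z.im) (h0 : z ≠ 0) :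
    -Complex.I * z ∈ Complex.slitPlane := by
  rw [Complex.mem_slitPlane_iff]
  rcases hz.lt_or_eq with h | h
  · left
    simpa using h
  · right
    have : z.re ≠ 0 := fun hre => h0 (Complex.ext hre h.symm)
    simpa using this

theorem hasDerivAt_rotLog {z : ℂ} (hz : 0 < z.im) : HasDerivAt rotLog (1 / z) z := by
  have h0 : z ≠ 0 := by
    rintro rfl
    simp at hz
  have h : HasDerivAt rotLog _ z :=
    ((hasDerivAt_id z).const_mul (-Complex.I)).clog (mem_slitPlane_of_im_nonneg hz.le h0)
  refine h.congr_deriv ?_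
  simp only [id]
  field_simp [Complex.I_ne_zero]

theorem hasDerivAt_chirpExponent (p : ℝ) (L : ℂ) :
    HasDerivAt (chirpExponent p)
      (-(1 + chirpSign p * Complex.I) * (2 * L) + (2 * Real.pi * Complex.I - 1 / p)) L := by
  have h : HasDerivAt (chirpExponent p) _ L :=
    ((hasDerivAt_pow 2 L).const_mul (-(1 + chirpSign p * Complex.I))).add
      ((hasDerivAt_id L).const_mul (2 * Real.pi * Complex.I - 1 / p))
  refine h.congr_deriv ?_
  norm_num

theorem continuous_chirpExponent (p : ℝ) : Continuous (chirpExponent p) := by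
  unfold chirpExponent
  fun_prop

/-- Completing the square with σ² = 1: on each ray the chirp only shifts the centre of the Gaussian
to σθ. -/
theorem chirpExponent_re (p u θ : ℝ) :
    (chirpExponent p (u + θ * Complex.I)).re =
      -(u - chirpSign p * θ) ^ 2 + 2 * θ ^ 2 - 2 * Real.pi * θ - u / p := by
  have hσ := chirpSign_mul_self p
  have e : (1 / p : ℂ) = ((1 / p : ℝ) : ℂ) := by push_cast; rfl
  rw [chirpExponent, e]
  simp only [pow_two, Complex.add_re, Complex.mul_re, Complex.neg_re, Complex.one_re,
    Complex.ofReal_re, Complex.I_re, Complex.I_im, Complex.ofReal_im, Complex.sub_re, Complex.add_im,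
    Complex.mul_im, Complex.neg_im, Complex.one_im, Complex.sub_im, Complex.re_ofNat,
    Complex.im_ofNat]
  linear_combination (θ ^ 2) * hσ

theorem rotLog_eq (z : ℂ) :
    rotLog z = ((rotLog z).re : ℂ) + ((rotLog z).im : ℂ) * Complex.I := (Complex.re_add_im _).symm

theorem abs_rotLog_im_le {z : ℂ} (hz : 0 ≤ z.im) : |(rotLog z).im| ≤ Real.pi / 2 := by
  rw [rotLog, Complex.log_im, Complex.abs_arg_le_pi_div_two_iff]
  simpa using hz

/-- Since |θ| ≤ π/2, the decay e^{-s²} in s = u - σθ beats everything else: the linear factor is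
absorbed into e^{|s|}, the term -u/p costs at most |s| + π/2, and 2θ² - 2πθ ≤ 3π²/2. The final 1
comes from 2|s| - s² ≤ 1. -/
theorem norm_logChirp_le {p : ℝ} (hp : 1 < p) (c₀ c₁ : ℂ) {z : ℂ} (hz : 0 ≤ z.im) :
    ‖logChirp p c₀ c₁ z‖ ≤
      (‖c₀‖ + Real.pi * ‖c₁‖) * Real.exp (1 + Real.pi / 2 + 3 * Real.pi ^ 2 / 2) := by
  have hpi := Real.pi_gt_three
  obtain ⟨u, θ, hL, hθ⟩ : ∃ u θ : ℝ, rotLog z = u + θ * Complex.I ∧ |θ| ≤ Real.pi / 2 :=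
    ⟨_, _, rotLog_eq z, abs_rotLog_im_le hz⟩
  set σ := chirpSign p with hσ
  have hσ1 : |σ| = 1 := by
    have := chirpSign_mul_self p
    rw [← abs_mul_abs_self] at this
    nlinarith [abs_nonneg (chirpSign p)]
  set s := u - σ * θ with hs
  have hu : |u| ≤ |s| + Real.pi / 2 := by
    have h1 : u = s + σ * θ := by rw [hs]; ring
    rw [h1]
    refine (abs_add_le _ _).trans ?_
    rw [abs_mul, hσ1, one_mul]
    linarith
  have hLn : ‖rotLog z‖ ≤ Real.pi * Real.exp |s| := by
    have h1 : ‖rotLog z‖ ≤ |u| + |θ| := by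
      rw [hL]
      refine (norm_add_le _ _).trans (le_of_eq ?_)
      simp
    nlinarith [Real.add_one_le_exp |s|, abs_nonneg s]
  have hre : (chirpExponent p (rotLog z)).re ≤ -s ^ 2 + |s| + Real.pi / 2 + 3 * Real.pi ^ 2 / 2 := by
    rw [hL, chirpExponent_re]
    have h1 : θ ^ 2 ≤ (Real.pi / 2) ^ 2 := sq_le_sq' (abs_le.mp hθ).1 (abs_le.mp hθ).2
    have h2 : -(u / p) ≤ |u| := by
      refine (neg_le_abs _).trans ?_
      rw [abs_div, abs_of_pos (zero_lt_one.trans hp)]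
      exact div_le_self (abs_nonneg _) hp.le
    have h3 : -θ ≤ Real.pi / 2 := (neg_le_abs θ).trans hθ
    have h4 : -(2 * Real.pi * θ) ≤ Real.pi ^ 2 := by nlinarith
    change -s ^ 2 + 2 * θ ^ 2 - 2 * Real.pi * θ - u / p ≤ _
    linarith
  rw [logChirp, norm_mul, Complex.norm_exp]
  have h5 : ‖c₀ + c₁ * rotLog z‖ ≤ (‖c₀‖ + Real.pi * ‖c₁‖) * Real.exp |s| := by
    refine (norm_add_le _ _).trans ?_
    rw [norm_mul]
    have h6 : 1 ≤ Real.exp |s| := Real.one_le_exp (abs_nonneg _)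
    nlinarith [norm_nonneg c₀, norm_nonneg c₁, mul_le_mul_of_nonneg_left hLn (norm_nonneg c₁),
      mul_le_mul_of_nonneg_left h6 (norm_nonneg c₀)]
  refine (mul_le_mul h5 (Real.exp_le_exp.mpr hre) (Real.exp_pos _).le (by positivity)).trans ?_
  rw [mul_assoc, ← Real.exp_add]
  refine mul_le_mul_of_nonneg_left (Real.exp_le_exp.mpr ?_) (by positivity)
  nlinarith [sq_abs s, sq_nonneg (|s| - 1)]

theorem hasDerivAt_logChirp (p : ℝ) (c₀ c₁ : ℂ) {z : ℂ} (hz : 0 < z.im) :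
    HasDerivAt (logChirp p c₀ c₁) ((c₁ + (c₀ + c₁ * rotLog z) *
      (-(1 + chirpSign p * Complex.I) * (2 * rotLog z) + (2 * Real.pi * Complex.I - 1 / p))) *
        Complex.exp (chirpExponent p (rotLog z)) / z) z := by
  have h1 := hasDerivAt_rotLog hz
  have h2 := ((hasDerivAt_chirpExponent p (rotLog z)).comp z h1).cexp
  have h3 := ((h1.const_mul c₁).const_add c₀).mul h2
  refine h3.congr_deriv ?_
  simp only [Function.comp_apply]
  ring

/-- The origin is a genuine exception: the default log 0 = 0 gives the value c₀ there, while the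
function tends to 0. The bound still holds at that point. -/
theorem boundedUpToBoundary_logChirp {p : ℝ} (hp : 1 < p) (c₀ c₁ : ℂ) :
    BoundedUpToBoundary (logChirp p c₀ c₁)
      ((‖c₀‖ + Real.pi * ‖c₁‖) * Real.exp (1 + Real.pi / 2 + 3 * Real.pi ^ 2 / 2)) where
  differentiableOn _ hz :=
    (hasDerivAt_logChirp p c₀ c₁ hz).differentiableAt.differentiableWithinAt
  continuousOn := by
    have h1 : ContinuousOn rotLog ({z | 0 ≤ z.im} \ {0}) :=
      ContinuousOn.clog (by fun_prop) fun z hz => mem_slitPlane_of_im_nonneg hz.1 hz.2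
    exact (continuousOn_const.add (continuousOn_const.mul h1)).mul
      (Complex.continuous_exp.comp_continuousOn ((continuous_chirpExponent p).comp_continuousOn h1))
  norm_le _ hz := norm_logChirp_le hp c₀ c₁ hz

theorem rotLog_exp (u : ℝ) :
    rotLog (Real.exp u : ℝ) = u + (-(Real.pi / 2) : ℝ) * Complex.I := by
  rw [rotLog, mul_comm, Complex.log_ofReal_mul (Real.exp_pos u) (by simp), Real.log_exp,
    Complex.log_neg_I]
  push_cast
  ring

theorem rotLog_neg_exp (u : ℝ) :
    rotLog (-Real.exp u : ℝ) = u + (Real.pi / 2 : ℝ) * Complex.I := by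
  rw [rotLog, show -Complex.I * ((-Real.exp u : ℝ) : ℂ) = (Real.exp u : ℝ) * Complex.I by
    push_cast; ring, Complex.log_ofReal_mul (Real.exp_pos u) (by simp), Real.log_exp, Complex.log_I]
  push_cast
  ring

/-- The `p`-th power of the boundary values in the logarithmic variable, on either half-line. -/
theorem exp_mul_norm_rpow {p : ℝ} (hp : 1 < p) (a ε u θ : ℝ) (hε : ε ^ 2 = 1) {x : ℂ}
    (hx : rotLog x = u + θ * Complex.I) :
    ENNReal.ofReal (Real.exp u) * ‖logChirp p (a - ε * (2 * Real.pi * Complex.I))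
        (ε * (2 * (1 + chirpSign p * Complex.I))) x‖ₑ ^ p =
      ENNReal.ofReal (Real.exp (p * (2 * θ ^ 2 - 2 * Real.pi * θ))) *
        ENNReal.ofReal (gaussDensity p a ε (2 * Real.pi - 4 * θ) (u - chirpSign p * θ)) := by
  have hp0 : 0 < p := by linarith
  have hσ := chirpSign_mul_self p
  set σ := chirpSign p with hσdef
  set s := u - σ * θ with hs
  rw [← ofReal_norm, ENNReal.ofReal_rpow_of_nonneg (norm_nonneg _) hp0.le,
    ← ENNReal.ofReal_mul (Real.exp_pos _).le, ← ENNReal.ofReal_mul (Real.exp_pos _).le]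
  congr 1
  rw [logChirp, hx, norm_mul, Complex.norm_exp, chirpExponent_re, ← hσdef, ← hs]
  have hσC : (σ : ℂ) * σ = 1 := by rw [← Complex.ofReal_mul, hσ, Complex.ofReal_one]
  have hlin : (a - ε * (2 * Real.pi * Complex.I) + ε * (2 * (1 + σ * Complex.I)) *
      (u + θ * Complex.I) : ℂ) =
      ((a + 2 * ε * s : ℝ) : ℂ) + ((-ε * (2 * Real.pi - 4 * θ - 2 * σ * s) : ℝ) : ℂ) * Complex.I := by
    rw [hs]
    push_cast
    linear_combination (2 * ε * σ * θ : ℂ) * Complex.I_sq + (2 * ε * θ * Complex.I : ℂ) * hσC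
  have hnorm : ‖(a - ε * (2 * Real.pi * Complex.I) + ε * (2 * (1 + σ * Complex.I)) *
      (u + θ * Complex.I) : ℂ)‖ ^ p =
      ((a + 2 * ε * s) ^ 2 + (2 * Real.pi - 4 * θ - 2 * σ * s) ^ 2) ^ (p / 2) := by
    rw [hlin, Complex.norm_add_mul_I, Real.sqrt_eq_rpow, ← Real.rpow_mul (by positivity)]
    congr 1
    · rw [mul_pow, neg_sq, hε, one_mul]
    · ring
  rw [Real.mul_rpow (norm_nonneg _) (Real.exp_pos _).le, hnorm, ← Real.exp_mul, gaussDensity,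
    ← hσdef]
  -- The Jacobian e^u cancels against the p-th power of e^{-u/p}.
  rw [mul_left_comm, mul_left_comm (Real.exp _), ← Real.exp_add, ← Real.exp_add]
  congr 2
  field_simp
  ring

/-- The positive half-line has θ = -π/2, hence b = 4π and 2θ² - 2πθ = 3π²/2; the negative one has θ
= π/2, hence b = 0 and -π²/2. Translation by σθ does not change the integrals. -/
theorem lintegral_logChirp {p : ℝ} (hp : 1 < p) (a ε : ℝ) (hε : ε ^ 2 = 1) :
    ∫⁻ x : ℝ, ‖logChirp p (a - ε * (2 * Real.pi * Complex.I))
        (ε * (2 * (1 + chirpSign p * Complex.I))) x‖ₑ ^ p =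
      ENNReal.ofReal (Real.exp (p * (3 * Real.pi ^ 2 / 2)) * (∫ s, gaussDensity p a ε (4 * Real.pi) s) +
        Real.exp (p * (-Real.pi ^ 2 / 2)) * ∫ s, gaussDensity p a ε 0 s) := by
  have hp0 : 0 < p := by linarith
  have hshift : ∀ b c : ℝ, ∫⁻ u, ENNReal.ofReal (gaussDensity p a ε b (u - c)) =
      ENNReal.ofReal (∫ s, gaussDensity p a ε b s) := fun b c => by
    rw [lintegral_sub_right_eq_self (fun u => ENNReal.ofReal (gaussDensity p a ε b u)),
      ofReal_integral_eq_lintegral_ofReal (integrable_gaussDensity hp0 a ε b)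
        (ae_of_all _ (gaussDensity_nonneg p a ε b))]
  have hnn : ∀ b, 0 ≤ ∫ s, gaussDensity p a ε b s := fun b =>
    integral_nonneg (gaussDensity_nonneg p a ε b)
  rw [lintegral_eq_lintegral_exp]
  simp only [exp_mul_norm_rpow hp a ε _ _ hε (rotLog_exp _),
    exp_mul_norm_rpow hp a ε _ _ hε (rotLog_neg_exp _)]
  rw [lintegral_const_mul' _ _ ENNReal.ofReal_ne_top, lintegral_const_mul' _ _ ENNReal.ofReal_ne_top,
    hshift, hshift, ← ENNReal.ofReal_mul (Real.exp_pos _).le,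
    ← ENNReal.ofReal_mul (Real.exp_pos _).le,
    ← ENNReal.ofReal_add (mul_nonneg (Real.exp_pos _).le (hnn _))
      (mul_nonneg (Real.exp_pos _).le (hnn _))]
  ring_nf

/-! ### The extremal functions and the strict inequality -/

namespace HardySpace

variable {p : ℝ} [hp : Fact (1 < p)]

/-- The extremal functions, for `ε = -1`, and their images, for `ε = 1`. -/
noncomputable def chirp (p : ℝ) [hp : Fact (1 < p)] (a ε : ℝ) (hε : ε ^ 2 = 1) : HardySpace p :=
  ⟨fun z => logChirp p (a - ε * (2 * Real.pi * Complex.I))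
      (ε * (2 * (1 + chirpSign p * Complex.I))) z, by
    have hb := boundedUpToBoundary_logChirp hp.out (a - ε * (2 * Real.pi * Complex.I))
      (ε * (2 * (1 + chirpSign p * Complex.I)))
    constructor
    · rw [UpperHalfPlane.mdifferentiable_iff]
      refine hb.differentiableOn.congr fun z hz => ?_
      rw [Function.comp_apply, ofComplex_apply_of_im_pos hz]
    · rw [hb.hardyENorm_eq hp.out, lintegral_logChirp hp.out a ε hε]
      exact ENNReal.rpow_lt_top_of_nonneg
        (one_div_nonneg.mpr (zero_lt_one.trans hp.out).le) ENNReal.ofReal_ne_top⟩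

theorem norm_chirp (a ε : ℝ) (hε : ε ^ 2 = 1) :
    ‖chirp p a ε hε‖ = (Real.exp (p * (3 * Real.pi ^ 2 / 2)) *
      (∫ s, gaussDensity p a ε (4 * Real.pi) s) +
        Real.exp (p * (-Real.pi ^ 2 / 2)) * ∫ s, gaussDensity p a ε 0 s) ^ (1 / p) := by
  have hp0 : 0 < p := zero_lt_one.trans hp.out
  have hnn : ∀ b, 0 ≤ ∫ s, gaussDensity p a ε b s := fun b =>
    integral_nonneg (gaussDensity_nonneg p a ε b)
  have hb := boundedUpToBoundary_logChirp hp.out (a - ε * (2 * Real.pi * Complex.I))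
      (ε * (2 * (1 + chirpSign p * Complex.I)))
  change (hardyENorm p fun z : ℍ => logChirp p (a - ε * (2 * Real.pi * Complex.I))
      (ε * (2 * (1 + chirpSign p * Complex.I))) z).toReal = _
  rw [hb.hardyENorm_eq hp.out, lintegral_logChirp hp.out a ε hε, ← ENNReal.toReal_rpow,
    ENNReal.toReal_ofReal]
  exact add_nonneg (mul_nonneg (Real.exp_pos _).le (hnn _)) (mul_nonneg (Real.exp_pos _).le (hnn _))

theorem norm_chirp_lt (hp2 : p ≠ 2) {a : ℝ} (ha : 0 < a) :
    ‖chirp p a (-1) (by norm_num)‖ < ‖chirp p a 1 (by norm_num)‖ := by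
  have hp0 : 0 < p := zero_lt_one.trans hp.out
  have hnn : ∀ b, 0 ≤ ∫ s, gaussDensity p a (-1) b s := fun b =>
    integral_nonneg (gaussDensity_nonneg p a (-1) b)
  rw [norm_chirp, norm_chirp]
  refine Real.rpow_lt_rpow ?_ ?_ (by positivity)
  · exact add_nonneg (mul_nonneg (Real.exp_pos _).le (hnn _))
      (mul_nonneg (Real.exp_pos _).le (hnn _))
  · rw [integral_gaussDensity_zero p a]
    have h := integral_gaussDensity_lt hp0 hp2 ha (b := 4 * Real.pi) (by positivity)
    have := mul_lt_mul_of_pos_left h (Real.exp_pos (p * (3 * Real.pi ^ 2 / 2)))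
    linarith

/-- The function h = `logChirp p 1 0` satisfies (zh)' = f, so t ↦ tz h(tz) is a primitive of the
segment integrand. -/
theorem cesaroCLM_chirp (z : ℍ) :
    cesaroCLM (chirp p (1 - 1 / p) (-1) (by norm_num)) z = logChirp p 1 0 z := by
  have hp0 : 0 < p := zero_lt_one.trans hp.out
  set f := chirp p (1 - 1 / p) (-1) (by norm_num) with hf
  have hz0 : (z : ℂ) ≠ 0 := UpperHalfPlane.ne_zero z
  have him : ∀ t : ℝ, 0 < t → 0 < (t * z : ℂ).im := fun t ht => by
    simpa using mul_pos ht z.im_pos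
  set h : ℂ → ℂ := logChirp p 1 0 with hh
  have hder : ∀ t : ℝ, 0 < t →
      HasDerivAt (fun t : ℝ => (t * z : ℂ) * h (t * z)) (segmentIntegrand f z t) t := by
    intro t ht
    have h1 := (hasDerivAt_id ((t : ℂ) * z)).mul (hasDerivAt_logChirp p 1 0 (him t ht))
    have h2 : HasDerivAt (fun t : ℂ => t * (z : ℂ)) (z : ℂ) (t : ℂ) := by
      simpa using (hasDerivAt_id (t : ℂ)).mul_const (z : ℂ)
    have h3 := (h1.comp (t : ℂ) h2).comp_ofReal
    refine h3.congr_deriv ?_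
    have hne : (t * z : ℂ) ≠ 0 := mul_ne_zero (Complex.ofReal_ne_zero.mpr ht.ne') hz0
    have hseg : segmentIntegrand f z t = logChirp p ((1 - 1 / p : ℝ) -
        ((-1 : ℝ) : ℂ) * (2 * Real.pi * Complex.I))
        (((-1 : ℝ) : ℂ) * (2 * (1 + chirpSign p * Complex.I))) (t * z) * z := by
      rw [segmentIntegrand, ofComplex_apply_of_im_pos (him t ht)]
      rfl
    rw [hseg]
    generalize (t * z : ℂ) = w at hne ⊢
    simp only [logChirp, id]
    push_cast
    field_simp
    ring
  -- The primitive is known to be differentiable only for t > 0, so its endpoint value at 0 is taken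
  -- as a limit; it vanishes because h is bounded.
  have hlim0 : Tendsto (fun t : ℝ => (t * z : ℂ) * h (t * z)) (𝓝[>] 0) (𝓝 0) := by
    have hb := boundedUpToBoundary_logChirp hp.out 1 0
    have h1 : Tendsto (fun t : ℝ => (t * z : ℂ)) (𝓝[>] 0) (𝓝 0) := by
      have : Continuous fun t : ℝ => (t * z : ℂ) := by fun_prop
      simpa using (this.tendsto 0).mono_left nhdsWithin_le_nhds
    refine h1.zero_mul_isBoundedUnder_le (isBoundedUnder_of_eventually_le
      (a := (‖(1 : ℂ)‖ + Real.pi * ‖(0 : ℂ)‖) *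
        Real.exp (1 + Real.pi / 2 + 3 * Real.pi ^ 2 / 2)) ?_)
    filter_upwards [self_mem_nhdsWithin] with t ht using hb.norm_le _ (him t ht).le
  have hlim1 : Tendsto (fun t : ℝ => (t * z : ℂ) * h (t * z)) (𝓝[<] 1) (𝓝 (z * h z)) := by
    have := (hder 1 one_pos).continuousAt.tendsto.mono_left (nhdsWithin_le_nhds (s := Iio 1))
    simpa using this
  rw [cesaroCLM_apply, cesaro, intervalIntegral.integral_eq_sub_of_hasDerivAt_of_tendsto one_pos
    (fun t ht => hder t ht.1) (f.intervalIntegrable_segmentIntegrand z) hlim0 hlim1]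
  field_simp
  ring

/-- This is (a - W)h + (a + W)h = 2ah, with 2a = 2(p - 1)/p for a = 1 - 1/p. -/
theorem cayley_chirp :
    (((2 * (p - 1) / p : ℝ) : ℂ) • cesaroCLM - ContinuousLinearMap.id ℂ (HardySpace p) :
      HardySpace p →L[ℂ] HardySpace p) (chirp p (1 - 1 / p) (-1) (by norm_num)) = chirp p (1 - 1 / p) 1 (by norm_num) := by
  have hp0 : (p : ℂ) ≠ 0 := Complex.ofReal_ne_zero.mpr (zero_lt_one.trans hp.out).ne'
  refine HardySpace.ext fun z => ?_
  change ((2 * (p - 1) / p : ℝ) : ℂ) * cesaroCLM (chirp p (1 - 1 / p) (-1) (by norm_num)) z -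
    chirp p (1 - 1 / p) (-1) (by norm_num) z = _
  rw [cesaroCLM_chirp]
  change _ * logChirp p 1 0 z - logChirp p _ _ z = logChirp p _ _ z
  simp only [logChirp]
  push_cast
  field_simp
  ring

end HardySpace

theorem mainTheorem1 (p : ℝ) [Fact (1 < p)] (hp2 : p ≠ 2) :
    ∃ C : HardySpace p →L[ℂ] HardySpace p,
      (∀ (f : HardySpace p) (z : ℍ),
        IntervalIntegrable (segmentIntegrand f z) volume 0 1 ∧ C f z = cesaro f z) ∧
      1 < ‖((2 * (p - 1) / p : ℝ) : ℂ) • C - ContinuousLinearMap.id ℂ (HardySpace p)‖ := by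
  have hp1 : 1 < p := Fact.out
  refine ⟨HardySpace.cesaroCLM, fun f z => ⟨f.intervalIntegrable_segmentIntegrand z,
    HardySpace.cesaroCLM_apply f z⟩, ?_⟩
  have ha : 0 < 1 - 1 / p := by
    rw [sub_pos, div_lt_one (by linarith)]
    exact hp1
  have hlt := HardySpace.norm_chirp_lt (p := p) hp2 ha
  rw [← HardySpace.cayley_chirp] at hlt
  set V : HardySpace p →L[ℂ] HardySpace p :=
    ((2 * (p - 1) / p : ℝ) : ℂ) • HardySpace.cesaroCLM - ContinuousLinearMap.id ℂ (HardySpace p)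
  -- If the norm of V were at most 1, V could not strictly increase the norm of the chirp.
  refine lt_of_not_ge fun hle => absurd hlt (not_lt.mpr ?_)
  simpa only [one_mul] using V.le_of_opNorm_le hle _
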